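/- Let $d,k\ge 0$ and $n\ge d+2$ be integers. **Polytopes.** A configuration $a_1,\dots,a_n$ in $\mathbb R^d$ is in *general position* if no $d+1$ of its points lie in a common hyperplane. A polytope $P$ is *$k$-neighborly* if the convex hull of every set of $k$ vertices of $P$ is a face of $P$ ($\emptyset$ and $P$ count as faces). **Triangulations.** A *triangulation* of a finite point set $B$ is a family $\mathcal T$ of affinely independent subsets of $B$ (its cells, each identified with the simplex it spans), closed under taking subsets, such that the simplices $\operatorname{conv}(S)$, $S\in\mathcal T$, cover $\operatorname{conv}(B)$ and $\operatorname{conv}(S)\cap\operatorname{conv}(S')=\operatorname{conv}(S\cap S')$ for all $S,S'\in\mathcal T$. It is *$k$-neighborly* if every $k$-element subset of $B$ is a cell of $\mathcal T$. **$K$-stereographic projection.** Let $K\subset\mathbb R^{d+2}$ be a smooth strictly convex body: a compact convex set with nonempty interior whose boundary contains no segment and which has a unique supporting hyperplane at every boundary point. Fix a point $c\in\partial K$ and a translate $H_c\not\ni c$ of the supporting hyperplane of $K$ at $c$, identified with $\mathbb R^{d+1}$ by an affine isomorphism. For $x\in K\setminus\{c\}$ let $\phi(x)\in H_c\cong\mathbb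 R^{d+1}$ be the point where the line through $c$ and $x$ meets $H_c$. For a hyperplane $H\subset\mathbb R^{d+2}$ with $c\notin H$, the set $\phi(H\cap\partial K)$ is a *$K$-sphere*, and $\phi(H\cap K)$ is the corresponding *$K$-ball*. The *$K$-circumball* spanned by $d+2$ affinely independent points of $\mathbb R^{d+1}$ is the $K$-ball corresponding to the $K$-sphere through these points. For a finite set $B\subset\mathbb R^{d+1}$, the *$K$-Delaunay subdivision* $\mathcal D_K(B)$ consists of all cells $S\subseteq B$ for which there is a $K$-sphere that contains $S$ and such that all points of $B\setminus S$ lie outside the corresponding $K$-ball. **$K$-liftings.** For a hyperplane $H=\{x:\langle x,v\rangle=t\}$ in $\mathbb R^{d+1}$ whose normal vector $v$ has positive last coordinate, a point $x$ is *above* (*below*) $H$ if $\langle x,v\rangle>t$ (resp. $<t$). A *$K$-lifting* of $a_1,\dots,a_n\in\mathbb R^d$ is a configuration of points $\hat a_i=(a_i,h_i)\in\mathbb R^{d+1}$, $1\le i\le n$, with $h_i\in\mathbb R$, such that 1. for each $i\ge d+2$, either $h_i>0$ and $\hat a_i$ is above every hyperplane spanned by points of $\{\hat a_1,\dots,\hat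 a_{i-1}\}$, or $h_i<0$ and $\hat a_i$ is below every such hyperplane; 2. for each $i>d+2$, $\hat a_i$ is contained in no $K$-circumball spanned by points of $\{\hat a_1,\dots,\hat a_{i-1}\}$. **Theorem.** Let $K\subset\mathbb R^{d+2}$ be a smooth strictly convex body with a fixed $K$-stereographic projection $\phi$. Let $A=\{a_1,\dots,a_n\}\subset\mathbb R^d$ be a configuration of $n\ge d+2$ distinct labeled points in general position that is the vertex set of a $k$-neighborly $d$-dimensional polytope $P$, and let $\hat A=\{\hat a_1,\dots,\hat a_n\}$ be a $K$-lifting of $A$. Then $\operatorname{conv}(\hat A)$ is a $k$-neighborly polytope with vertex set $\hat A$, and the $K$-Delaunay subdivision $\mathcal D_K(\hat A)$ is a $(k+1)$-neighborly triangulation of $\hat A$. -/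

import Mathlib

open scoped RealInnerProductSpace

noncomputable section

namespace Neighborly

/-- Euclidean space of dimension `d`. -/
abbrev E (d : ℕ) : Type := EuclideanSpace ℝ (Fin d)

/-- The set `{x | ⟪v, x⟫ = t}`, a hyperplane when `v ≠ 0`. -/
def hyperplane {d : ℕ} (v : E d) (t : ℝ) : Set (E d) := {x | ⟪v, x⟫ = t}

/-- `H` is an affine hyperplane. -/
def IsHyperplane {d : ℕ} (H : Set (E d)) : Prop :=
  ∃ (v : E d) (t : ℝ), v ≠ 0 ∧ H = hyperplane v t

/-! ### Point configurations and polytopes -/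

/-- No `d + 1` points of the labeled configuration lie in a common hyperplane. -/
def GeneralPosition {d n : ℕ} (a : Fin n → E d) : Prop :=
  ∀ S : Finset (Fin n), S.card = d + 1 →
    ∀ H : Set (E d), IsHyperplane H → ¬ ∀ i ∈ S, a i ∈ H

/-- `P` is a polytope: the convex hull of a finite set. -/
def IsPolytope {d : ℕ} (P : Set (E d)) : Prop :=
  ∃ F : Finset (E d), P = convexHull ℝ (F : Set (E d))

/-- `P` is a `k`-neighborly polytope: every set of `k` vertices of `P` is the vertex set of a face
of `P`.  Faces are the exposed faces, including `∅` and `P` itself. -/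
def IsNeighborlyPolytope {d : ℕ} (k : ℕ) (P : Set (E d)) : Prop :=
  IsPolytope P ∧
    ∀ S : Finset (E d), (S : Set (E d)) ⊆ P.extremePoints ℝ → S.card = k →
      IsExposed ℝ P (convexHull ℝ (S : Set (E d)))

/-! ### Triangulations

A collection of simplices is given by the collection of the vertex sets of the simplices; the empty
simplex is allowed. -/

/-- `T` is (the collection of vertex sets of the cells, of all dimensions, of) a triangulation
of the point set `A`. -/
structure IsTriangulation {d : ℕ} (A : Set (E d)) (T : Set (Finset (E d))) : Prop where
  subset : ∀ S ∈ T, (S : Set (E d)) ⊆ A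
  affineIndependent : ∀ S ∈ T, AffineIndependent ℝ ((↑) : S → E d)
  down_closed : ∀ S ∈ T, ∀ S' ⊆ S, S' ∈ T
  cover : (⋃ S ∈ T, convexHull ℝ (S : Set (E d))) = convexHull ℝ A
  inter : ∀ S ∈ T, ∀ S' ∈ T,
    convexHull ℝ (S : Set (E d)) ∩ convexHull ℝ (S' : Set (E d)) =
      convexHull ℝ ((S : Set (E d)) ∩ (S' : Set (E d)))

/-- `T` is a `k`-neighborly triangulation of `A`: a triangulation in which every `k` points of `A`
span a cell. -/
def IsNeighborlyTriangulation {d : ℕ} (k : ℕ) (A : Set (E d)) (T : Set (Finset (E d))) : Prop :=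
  IsTriangulation A T ∧ ∀ S : Finset (E d), (S : Set (E d)) ⊆ A → S.card = k → S ∈ T

/-! ### Smooth strictly convex bodies and stereographic projections -/

/-- `v` is an outer normal vector of a supporting hyperplane of `K` at `c`. -/
def IsOuterNormal {d : ℕ} (K : Set (E d)) (c v : E d) : Prop :=
  v ≠ 0 ∧ ∀ x ∈ K, ⟪v, x⟫ ≤ ⟪v, c⟫

/-- `H` is a supporting hyperplane of `K` at the boundary point `c`. -/
def IsSupportingHyperplane {d : ℕ} (K : Set (E d)) (c : E d) (H : Set (E d)) : Prop :=
  ∃ v, IsOuterNormal K c v ∧ H = hyperplane v ⟪v, c⟫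

/-- `K` is a smooth strictly convex body. -/
structure IsSmoothStrictlyConvexBody {d : ℕ} (K : Set (E d)) : Prop where
  isCompact : IsCompact K
  interior_nonempty : (interior K).Nonempty
  strictConvex : StrictConvex ℝ K
  smooth : ∀ c ∈ frontier K, ∃! H : Set (E d), IsSupportingHyperplane K c H

/-- The data of a `K`-stereographic projection of `∂K`, where `K ⊆ ℝᵐ⁺¹`, onto `ℝᵐ`: a center on the
boundary of `K`, and a translate of a supporting hyperplane of `K` at the center which avoids the
center, identified with `ℝᵐ` by an affine isomorphism `chart` onto that translate. -/
structure StereographicProjection {m : ℕ} (K : Set (E (m + 1))) where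
  center : E (m + 1)
  center_mem : center ∈ frontier K
  chart : E m →ᵃ[ℝ] E (m + 1)
  chart_injective : Function.Injective chart
  range_chart : ∃ v t, IsOuterNormal K center v ∧ t ≠ ⟪v, center⟫ ∧
    Set.range chart = hyperplane v t

namespace StereographicProjection

variable {m : ℕ} {K : Set (E (m + 1))}

/-- The projection itself: `proj x` is the point of `ℝᵐ` identified with the unique point in which
the line through the center and `x` meets the translated supporting hyperplane.  (Meaningful
for every `x ∈ K` different from the center.) -/
def proj (σ : StereographicProjection K) (x : E (m + 1)) : E m :=
  Classical.epsilon fun p => σ.chart p ∈ line[ℝ, σ.center, x]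

/-- The `K`-sphere cut out by a hyperplane `H` (which must avoid the center). -/
def sphere (σ : StereographicProjection K) (H : Set (E (m + 1))) : Set (E m) :=
  σ.proj '' (H ∩ frontier K)

/-- The `K`-ball cut out by a hyperplane `H` (which must avoid the center). -/
def ball (σ : StereographicProjection K) (H : Set (E (m + 1))) : Set (E m) :=
  σ.proj '' (H ∩ K)

/-- `B` is the `K`-circumball spanned by the `m + 1` affinely independent points of `S ⊆ ℝᵐ`. -/
def IsCircumball (σ : StereographicProjection K) (S : Finset (E m)) (B : Set (E m)) : Prop :=
  S.card = m + 1 ∧ AffineIndependent ℝ ((↑) : S → E m) ∧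
    ∃ H : Set (E (m + 1)), IsHyperplane H ∧ σ.center ∉ H ∧
      (S : Set (E m)) ⊆ σ.sphere H ∧ B = σ.ball H

/-- The `K`-Delaunay subdivision of `A`: the sets `S ⊆ A` that lie on a `K`-sphere
such that all the remaining points of `A` are outside the corresponding `K`-ball. -/
def delaunay (σ : StereographicProjection K) (A : Set (E m)) : Set (Finset (E m)) :=
  {S | (S : Set (E m)) ⊆ A ∧ ∃ H : Set (E (m + 1)), IsHyperplane H ∧ σ.center ∉ H ∧
    (S : Set (E m)) ⊆ σ.sphere H ∧ ∀ p ∈ A, p ∉ S → p ∉ σ.ball H}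

end StereographicProjection

/-! ### Liftings -/

/-- The point `(a, h)` of `ℝᵈ⁺¹`. -/
def liftPoint {d : ℕ} (a : E d) (h : ℝ) : E (d + 1) :=
  WithLp.toLp 2 (Fin.snoc (α := fun _ => ℝ) (fun j => a j) h)

/-- `x` is above every hyperplane spanned by points of `B`; hyperplanes are presented by
normal vectors with positive last coordinate. -/
def AboveAll {d : ℕ} (B : Set (E (d + 1))) (x : E (d + 1)) : Prop :=
  ∀ (v : E (d + 1)) (t : ℝ), 0 < v (Fin.last d) →
    (∃ S ⊆ B, (affineSpan ℝ S : Set (E (d + 1))) = hyperplane v t) → t < ⟪v, x⟫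

/-- `x` is below every hyperplane spanned by points of `B`. -/
def BelowAll {d : ℕ} (B : Set (E (d + 1))) (x : E (d + 1)) : Prop :=
  ∀ (v : E (d + 1)) (t : ℝ), 0 < v (Fin.last d) →
    (∃ S ⊆ B, (affineSpan ℝ S : Set (E (d + 1))) = hyperplane v t) → ⟪v, x⟫ < t

/-- `b` is a lexicographic lifting of `a`.  The labels run over `0, …, n - 1`, so that
the condition on the label `i ≥ d + 2` of `1, …, n` reads `d + 1 ≤ i`. -/
def IsLexLifting {d n : ℕ} (a : Fin n → E d) (b : Fin n → E (d + 1)) : Prop :=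
  ∃ h : Fin n → ℝ, (∀ i, b i = liftPoint (a i) (h i)) ∧
    ∀ i : Fin n, d + 1 ≤ (i : ℕ) →
      (0 < h i ∧ AboveAll (b '' {j | j < i}) (b i)) ∨
      (h i < 0 ∧ BelowAll (b '' {j | j < i}) (b i))

/-- `b` is a `K`-lifting of `a`, with respect to the `K`-stereographic projection `σ`. -/
def IsKLifting {d n : ℕ} {K : Set (E (d + 1 + 1))} (σ : StereographicProjection K)
    (a : Fin n → E d) (b : Fin n → E (d + 1)) : Prop :=
  IsLexLifting a b ∧
    ∀ i : Fin n, d + 2 ≤ (i : ℕ) →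
      ∀ (S : Finset (E (d + 1))) (B : Set (E (d + 1))),
        (S : Set (E (d + 1))) ⊆ b '' {j | j < i} → σ.IsCircumball S B → b i ∉ B

end Neighborly

end

/-!
The proof has two halves, joined by a height function.

*From `K` to heights.* Put the origin at the center `c` of the projection and write the points of `K`
other than `c` as `c + s • D p`, where `s > 0`, the point `p` is the stereographic image, and `D` is the
chart rescaled to point to the inner side of the tangent hyperplane at `c`. In the coordinates
`(p, 1 / s)` the center moves to infinity and `K` becomes the region above the graph of a positive
function `G`, defined everywhere because `K` is smooth at `c`. Hyperplanes avoiding `c` become graphs of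
affine functions, so the `K`-spheres and `K`-balls are the sets `{G = g}` and `{G ≤ g}` with `g` affine
(`StereographicProjection.exists_height`). Hence the `K`-Delaunay subdivision is the regular
subdivision with heights `G` (`mem_delaunay_iff`), and the circumball condition says that every new
point is placed, in the heights `G`, above all affine interpolants of earlier points
(`IsKLifting.isPlacing`).

*Placing points.* Two cells of a regular subdivision always meet in a common face, and the cells always
cover the convex hull. The placing condition makes the cells affinely independent
(`IsLowerCell.affineIndependent`) and makes old cells persist when points are added
(`IsLowerCell.persist`). It remains to see that `k + 1` points always span a cell. Unless all of them
belong to the initial simplex, let `b i` be the last of them. The other `k` project to a face of the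
neighborly polytope, so they span a face of the earlier points with a vertical supporting hyperplane.
This hyperplane can be tilted, in either direction, to one spanned by earlier points, and the lifting
puts `b i` beyond it (`IsLexLifting.exists_visible_face`). So `b i` sees the face, and placing `b i`
creates the cell they span together (`isLowerCell_insert`).

The statement about the convex hull of the lifted points holds because supporting hyperplanes of the
base polytope pull back along the vertical projection (`isNeighborlyPolytope_lift`).
-/

noncomputable section

namespace Neighborly

/-! ### Affine functions with prescribed values -/

section AffineFunctions

/-- A finite set of strict inequalities survives a small perturbation. -/
lemma exists_pos_forall_mul_lt {X : Type*} {A : Set X} (hA : A.Finite) (α β : X → ℝ)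
    (hα : ∀ x ∈ A, 0 < α x) : ∃ ε > 0, ∀ x ∈ A, ε * β x < α x := by
  have hev : ∀ᶠ ε in nhdsWithin (0 : ℝ) (Set.Ioi 0), ∀ x ∈ A, ε * β x < α x := by
    rw [Filter.eventually_all_finite hA]
    intro x hx
    have hc : Filter.Tendsto (fun ε : ℝ => ε * β x) (nhdsWithin 0 (Set.Ioi 0)) (nhds (0 * β x)) :=
      ((continuous_id.mul continuous_const).tendsto 0).mono_left nhdsWithin_le_nhds
    rw [zero_mul] at hc
    exact hc.eventually_lt_const (hα x hx)
  obtain ⟨ε, h1, h2⟩ := (hev.and self_mem_nhdsWithin).exists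
  exact ⟨ε, h2, h1⟩

variable {V : Type*} [AddCommGroup V] [Module ℝ V]

lemma exists_affineMap_eq_zero_and_eq_one {T : Set V} {p : V} (hp : p ∉ affineSpan ℝ T) :
    ∃ q : V →ᵃ[ℝ] ℝ, (∀ x ∈ T, q x = 0) ∧ q p = 1 := by
  rcases T.eq_empty_or_nonempty with rfl | ⟨t₀, ht₀⟩
  · exact ⟨AffineMap.const ℝ V 1, by simp, by simp⟩
  · have hdir : p - t₀ ∉ (affineSpan ℝ T).direction := by
      intro h
      apply hp
      have := AffineSubspace.vadd_mem_of_mem_direction h (subset_affineSpan ℝ T ht₀)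
      simpa using this
    obtain ⟨f, hf, hker⟩ := Submodule.exists_le_ker_of_notMem hdir
    refine ⟨((f (p - t₀))⁻¹ • f).toAffineMap - AffineMap.const ℝ V ((f (p - t₀))⁻¹ * f t₀),
      ?_, ?_⟩
    · intro x hx
      have : f (x - t₀) = 0 := by
        have := hker (AffineSubspace.vsub_mem_direction (subset_affineSpan ℝ T hx)
          (subset_affineSpan ℝ T ht₀))
        simpa using this
      rw [map_sub, sub_eq_zero] at this
      simp [this]
    · simp only [AffineMap.coe_sub, Pi.sub_apply, LinearMap.coe_toAffineMap, LinearMap.smul_apply, smul_eq_mul,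
        AffineMap.const_apply, ← mul_sub, ← map_sub]
      exact inv_mul_cancel₀ hf

lemma notMem_affineSpan_of_affineIndependent_insert {S : Set V} {p : V} (hp : p ∉ S)
    (h : AffineIndependent ℝ ((↑) : ↥(insert p S) → V)) : p ∉ affineSpan ℝ S := by
  have := h.notMem_affineSpan_sdiff ⟨p, Set.mem_insert p S⟩ Set.univ
  convert this using 3
  ext x
  simp only [Set.mem_image, Set.mem_sdiff, Set.mem_univ, true_and, Set.mem_singleton_iff,
    Subtype.exists, Subtype.mk.injEq, exists_and_right, exists_eq_right]
  constructor
  · rintro hx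
    exact ⟨Set.mem_insert_of_mem _ hx, fun h => hp (h ▸ hx)⟩
  · rintro ⟨hx, hne⟩
    exact hx.resolve_left hne

lemma affineIndependent_insert {S : Set V} {p : V} (hp : p ∉ affineSpan ℝ S)
    (h : AffineIndependent ℝ ((↑) : S → V)) :
    AffineIndependent ℝ ((↑) : ↥(insert p S) → V) := by
  classical
  have hpS : p ∉ S := fun h => hp (subset_affineSpan ℝ S h)
  let i : (insert p S : Set V) := ⟨p, Set.mem_insert p S⟩
  refine AffineIndependent.affineIndependent_of_notMem_span (i := i) ?_ ?_
  · have hS : ∀ x : {y : (insert p S : Set V) // y ≠ i}, ((x : (insert p S : Set V)) : V) ∈ S := by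
      rintro ⟨⟨x, hx⟩, hne⟩
      exact hx.resolve_left fun h => hne (Subtype.ext h)
    exact h.comp_embedding ⟨fun x => ⟨_, hS x⟩, fun x y hxy => by
      apply Subtype.ext; apply Subtype.ext
      simpa using hxy⟩
  · have hval : Subtype.val '' {x : ↥(insert p S) | x ≠ i} = S := by
      ext x
      constructor
      · rintro ⟨⟨x, hx⟩, hne, rfl⟩
        exact hx.resolve_left fun h => hne (Subtype.ext h)
      · intro hx
        refine ⟨⟨x, Set.mem_insert_of_mem _ hx⟩, fun h => ?_, rfl⟩
        have hxp : x = p := congrArg Subtype.val h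
        exact hpS (hxp ▸ hx)
    rwa [hval]

/-- A function on a finite affinely independent set extends to an affine function. -/
lemma exists_affineMap_eqOn {S : Set V} (hfin : S.Finite)
    (hS : AffineIndependent ℝ ((↑) : S → V)) (f : V → ℝ) :
    ∃ g : V →ᵃ[ℝ] ℝ, ∀ x ∈ S, g x = f x := by
  induction S, hfin using Set.Finite.induction_on with
  | empty => exact ⟨0, by simp⟩
  | @insert p S hp _ ih =>
    obtain ⟨g, hg⟩ := ih (hS.mono (Set.subset_insert p S))
    obtain ⟨q, hq0, hq1⟩ := exists_affineMap_eq_zero_and_eq_one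
      (notMem_affineSpan_of_affineIndependent_insert hp hS)
    refine ⟨g + (f p - g p) • q, ?_⟩
    rintro x (rfl | hx)
    · simp [hq1]
    · simp [hq0 x hx, hg x hx]

lemma eq_of_mem_affineSpan {T : Set V} {g g' : V →ᵃ[ℝ] ℝ} (h : ∀ x ∈ T, g x = g' x) {p : V}
    (hp : p ∈ affineSpan ℝ T) : g p = g' p := by
  by_contra hne
  have : affineSpan ℝ T ≤ (affineSpan ℝ {(0 : ℝ)}).comap (g - g') := by
    rw [affineSpan_le]
    intro x hx
    simp [h x hx]
  have := this hp
  simp [sub_eq_zero] at this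
  exact hne this

/-- A point of a convex hull at which an affine function attains a maximum `0` over the generators
lies in the convex hull of the generators where the function vanishes. -/
lemma mem_convexHull_of_affineMap_nonneg {A : Set V} (u : V →ᵃ[ℝ] ℝ) (hu : ∀ x ∈ A, u x ≤ 0) {p : V}
    (hp : p ∈ convexHull ℝ A) (hp0 : 0 ≤ u p) : p ∈ convexHull ℝ {x ∈ A | u x = 0} := by
  have hsub : convexHull ℝ A ⊆
      {x | u x < 0} ∪ {x | u x = 0 ∧ x ∈ convexHull ℝ {x ∈ A | u x = 0}} := by
    refine convexHull_min ?_ ?_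
    · intro x hx
      rcases (hu x hx).lt_or_eq with h | h
      · exact Or.inl h
      · exact Or.inr ⟨h, subset_convexHull ℝ _ ⟨hx, h⟩⟩
    · rw [convex_iff_pairwise_pos]
      intro x hx y hy _ s t hs ht hst
      have hu' : u (s • x + t • y) = s * u x + t * u y := Convex.combo_affine_apply hst
      rcases hx with hx | hx <;> rcases hy with hy | hy
      · left; simp only [Set.mem_ofPred_eq] at *; rw [hu']; nlinarith
      · left; simp only [Set.mem_ofPred_eq] at *; rw [hu', hy.1]; nlinarith
      · left; simp only [Set.mem_ofPred_eq] at *; rw [hu', hx.1]; nlinarith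
      · right
        refine ⟨by rw [hu', hx.1, hy.1]; simp, convex_convexHull ℝ _ hx.2 hy.2 hs.le ht.le hst⟩
  rcases hsub hp with h | h
  · exact absurd h (not_lt.2 hp0)
  · exact h.2

end AffineFunctions

/-! ### Regular subdivisions -/

section RegularSubdivision

variable {V : Type*} [AddCommGroup V] [Module ℝ V]

/-- `S` is a cell of the regular subdivision of `A` induced by the heights `G`: some affine function
agrees with `G` on `S` and is strictly smaller than `G` on `A \ S`. -/
def IsLowerCell (G : V → ℝ) (A S : Set V) : Prop :=
  S ⊆ A ∧ ∃ g : V →ᵃ[ℝ] ℝ, (∀ x ∈ S, g x = G x) ∧ ∀ x ∈ A, x ∉ S → g x < G x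

variable {G : V → ℝ} {A S T : Set V}

lemma isLowerCell_setOf_eq (g : V →ᵃ[ℝ] ℝ) (hg : ∀ x ∈ A, g x ≤ G x) :
    IsLowerCell G A {x ∈ A | g x = G x} :=
  ⟨Set.sep_subset _ _, g, fun _ hx => hx.2, fun x hx hxS =>
    lt_of_le_of_ne (hg x hx) fun h => hxS ⟨hx, h⟩⟩

lemma IsLowerCell.exists_le (h : IsLowerCell G A S) :
    ∃ g : V →ᵃ[ℝ] ℝ, (∀ x ∈ S, g x = G x) ∧ (∀ x ∈ A, g x ≤ G x) ∧
      ∀ x ∈ A, g x = G x → x ∈ S := by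
  obtain ⟨_, g, hg, hlt⟩ := h
  refine ⟨g, hg, fun x hx => ?_, fun x hx he => ?_⟩
  · by_cases hxS : x ∈ S
    · exact (hg x hxS).le
    · exact (hlt x hx hxS).le
  · by_contra hxS
    exact (hlt x hx hxS).ne he

/-- Two cells of a regular subdivision meet in their common face. -/
lemma IsLowerCell.convexHull_inter (hS : IsLowerCell G A S) (hT : IsLowerCell G A T) :
    convexHull ℝ S ∩ convexHull ℝ T = convexHull ℝ (S ∩ T) := by
  apply Set.Subset.antisymm
  · rintro p ⟨hpS, hpT⟩
    obtain ⟨g, hg, hgle, -⟩ := hS.exists_le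
    obtain ⟨g', hg', hgle', hg't⟩ := hT.exists_le
    have hT0 : g p ≤ g' p := by
      have : convexHull ℝ T ⊆ (g - g') ⁻¹' Set.Iic 0 := by
        refine convexHull_min ?_ ((convex_Iic 0).affine_preimage _)
        intro x hx
        simpa [hg' x hx] using hgle x (hT.1 hx)
      simpa using this hpT
    have := mem_convexHull_of_affineMap_nonneg (g' - g)
      (fun x hx => by simpa [hg x hx] using hgle' x (hS.1 hx)) hpS (by simpa using hT0)
    refine convexHull_mono ?_ this
    rintro x ⟨hx, h0⟩
    refine ⟨hx, hg't x (hS.1 hx) ?_⟩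
    simp [hg x hx, sub_eq_zero] at h0
    exact h0
  · exact Set.subset_inter (convexHull_mono Set.inter_subset_left)
      (convexHull_mono Set.inter_subset_right)

/-- Faces of affinely independent cells are cells. -/
lemma IsLowerCell.of_subset (hA : A.Finite) (hS : IsLowerCell G A S)
    (hind : AffineIndependent ℝ ((↑) : S → V)) (hTS : T ⊆ S) : IsLowerCell G A T := by
  classical
  refine ⟨hTS.trans hS.1, ?_⟩
  obtain ⟨hSA, g, hg, hlt⟩ := hS
  obtain ⟨q, hq⟩ := exists_affineMap_eqOn (hA.subset hSA) hind (fun x => if x ∈ T then 0 else -1)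
  obtain ⟨ε, hε, hεlt⟩ := exists_pos_forall_mul_lt (hA.subset Set.sdiff_subset : (A \ S).Finite)
    (fun x => G x - g x) q (fun x hx => sub_pos.2 (hlt x hx.1 hx.2))
  refine ⟨g + ε • q, fun x hx => ?_, fun x hx hxT => ?_⟩
  · simp [hg x (hTS hx), hq x (hTS hx), hx]
  · by_cases hxS : x ∈ S
    · simp [hg x hxS, hq x hxS, hxT, hε]
    · have := hεlt x ⟨hx, hxS⟩
      simp only [AffineMap.coe_add, AffineMap.coe_smul, Pi.add_apply, Pi.smul_apply, smul_eq_mul]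
      linarith

/-- An affinely independent face of the convex hull of `A` is a cell. -/
lemma isLowerCell_of_face (hA : A.Finite) (hSA : S ⊆ A)
    (hind : AffineIndependent ℝ ((↑) : S → V)) (u : V →ᵃ[ℝ] ℝ) (hu : ∀ x ∈ S, u x = 0)
    (hu' : ∀ x ∈ A, x ∉ S → u x < 0) : IsLowerCell G A S := by
  obtain ⟨g, hg⟩ := exists_affineMap_eqOn (hA.subset hSA) hind G
  obtain ⟨ε, hε, hεlt⟩ := exists_pos_forall_mul_lt (hA.subset Set.sdiff_subset : (A \ S).Finite)
    (fun x => - u x) (fun x => g x - G x) (fun x hx => by simpa using hu' x hx.1 hx.2)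
  refine ⟨hSA, g + ε⁻¹ • u, fun x hx => by simp [hg x hx, hu x hx], fun x hx hxS => ?_⟩
  have := hεlt x ⟨hx, hxS⟩
  have h2 : g x - G x < ε⁻¹ * (- u x) := by rwa [lt_inv_mul_iff₀ hε]
  simp only [AffineMap.coe_add, AffineMap.coe_smul, Pi.add_apply, Pi.smul_apply, smul_eq_mul]
  linarith

/-- An affine minorant of `G` on a finite spanning set can be tilted, keeping all its contact
points, until its contact points span. -/
lemma exists_le_affineSpan_eq_top (hA : A.Finite) (hspan : affineSpan ℝ A = ⊤) (g : V →ᵃ[ℝ] ℝ)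
    (hg : ∀ x ∈ A, g x ≤ G x) :
    ∃ g' : V →ᵃ[ℝ] ℝ, (∀ x ∈ A, g' x ≤ G x) ∧ (∀ x ∈ A, g x = G x → g' x = G x) ∧
      affineSpan ℝ {x ∈ A | g' x = G x} = ⊤ := by
  -- A minorant with a maximal set of contact points will do.
  let C : Set (Set V) := {T | T ⊆ A ∧ ∃ g' : V →ᵃ[ℝ] ℝ, (∀ x ∈ A, g' x ≤ G x) ∧
    (∀ x ∈ A, g x = G x → g' x = G x) ∧ T = {x ∈ A | g' x = G x}}
  have hCfin : C.Finite := hA.finite_subsets.subset fun T hT => hT.1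
  have hCne : C.Nonempty := ⟨{x ∈ A | g x = G x}, Set.sep_subset _ _, g, hg, fun _ _ h => h, rfl⟩
  obtain ⟨T, hTmax⟩ := hCfin.exists_maximal hCne
  obtain ⟨hTA, g', hle, hcont, rfl⟩ := hTmax.prop
  refine ⟨g', hle, hcont, ?_⟩
  by_contra hne
  obtain ⟨p, hpA, hp⟩ : ∃ p ∈ A, p ∉ affineSpan ℝ {x ∈ A | g' x = G x} := by
    by_contra! hall
    exact hne (top_le_iff.1 (hspan ▸ affineSpan_le.2 hall))
  obtain ⟨q, hq0, hq1⟩ := exists_affineMap_eq_zero_and_eq_one hp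
  obtain ⟨y, ⟨hyA, hqy⟩, hmin⟩ := (hA.subset (Set.sep_subset A (fun x => 0 < q x))).exists_minimalFor
    (fun x => (G x - g' x) / q x) _ ⟨p, hpA, by rw [hq1]; exact one_pos⟩
  set c := (G y - g' y) / q y with hc
  have hc0 : 0 ≤ c := div_nonneg (sub_nonneg.2 (hle y hyA)) hqy.le
  have hyT : (g' + c • q) y = G y := by
    simp only [AffineMap.coe_add, AffineMap.coe_smul, Pi.add_apply, Pi.smul_apply, smul_eq_mul, hc]
    field_simp
    ring
  have hsub : {x ∈ A | g' x = G x} ⊆ {x ∈ A | (g' + c • q) x = G x} := by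
    rintro x ⟨hxA, hx⟩
    exact ⟨hxA, by simp [hq0 x ⟨hxA, hx⟩, hx]⟩
  have hmem : {x ∈ A | (g' + c • q) x = G x} ∈ C := by
    refine ⟨Set.sep_subset _ _, g' + c • q, fun x hx => ?_, fun x hx h =>
      (hsub ⟨hx, hcont x hx h⟩).2, rfl⟩
    simp only [AffineMap.coe_add, AffineMap.coe_smul, Pi.add_apply, Pi.smul_apply, smul_eq_mul]
    rcases le_or_gt (q x) 0 with h | h
    · nlinarith [hle x hx]
    · have : c ≤ (G x - g' x) / q x := by
        rcases le_total c ((G x - g' x) / q x) with h' | h'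
        · exact h'
        · exact hmin ⟨hx, h⟩ h'
      rw [le_div_iff₀ h] at this
      linarith
  have hyT' : y ∈ {x ∈ A | g' x = G x} := hTmax.le_of_ge hmem hsub ⟨hyA, hyT⟩
  rw [hq0 y hyT'] at hqy
  exact lt_irrefl _ hqy

end RegularSubdivision

section Cover

variable {m : ℕ} {G : E m → ℝ} {A : Set (E m)}

/-- Affine minorants of `G` with the largest possible value at an interior point exist. -/
lemma exists_affineMap_le_forall_apply_le (hA : A.Finite) {p : E m}
    (hp : p ∈ interior (convexHull ℝ A)) :
    ∃ g : E m →ᵃ[ℝ] ℝ, (∀ x ∈ A, g x ≤ G x) ∧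
      ∀ g' : E m →ᵃ[ℝ] ℝ, (∀ x ∈ A, g' x ≤ G x) → g' p ≤ g p := by
  obtain ⟨r, hr, hball⟩ := Metric.mem_nhds_iff.1 (mem_interior_iff_mem_nhds.1 hp)
  obtain ⟨M, hM⟩ := (hA.image G).bddAbove
  obtain ⟨c, hc⟩ := (hA.image G).bddBelow
  -- The minorant `y ↦ ⟪v, y - p⟫ + t` is encoded by the pair `(v, t)`.
  let C : Set (E m × ℝ) := {w | (∀ x ∈ A, ⟪w.1, x - p⟫ + w.2 ≤ G x) ∧ c ≤ w.2}
  have hCcl : IsClosed C := by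
    have : C = (⋂ x ∈ A, {w : E m × ℝ | ⟪w.1, x - p⟫ + w.2 ≤ G x}) ∩ {w | c ≤ w.2} := by
      ext w; simp [C]
    rw [this]
    refine IsClosed.inter (isClosed_biInter fun x _ => isClosed_le ?_ ?_) (isClosed_le ?_ ?_) <;>
      fun_prop
  have hupper : ∀ w ∈ C, ∀ y ∈ convexHull ℝ A, ⟪w.1, y - p⟫ + w.2 ≤ M := by
    intro w hw y hy
    have hconv : Convex ℝ {y : E m | ⟪w.1, y - p⟫ + w.2 ≤ M} := by
      have : {y : E m | ⟪w.1, y - p⟫ + w.2 ≤ M} = {y : E m | ⟪w.1, y⟫ ≤ M - w.2 + ⟪w.1, p⟫} := by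
        ext y
        simp only [Set.mem_ofPred_eq, inner_sub_right]
        constructor <;> intro h <;> linarith
      rw [this]
      exact convex_halfSpace_le (innerₛₗ ℝ w.1).isLinear _
    refine convexHull_min (fun x hx => ?_) hconv hy
    exact (hw.1 x hx).trans (hM (Set.mem_image_of_mem G hx))
  have hCbd : Bornology.IsBounded C := by
    refine (Metric.isBounded_closedBall (x := (0 : E m × ℝ))
      (r := max ((M - c) / (r / 2)) (max |c| |M|))).subset fun w hw => ?_
    rw [mem_closedBall_zero_iff, Prod.norm_def]
    have ht : w.2 ≤ M := by
      have := hupper w hw p (interior_subset hp)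
      simpa using this
    refine max_le_max ?_ ?_
    · rw [le_div_iff₀ (half_pos hr)]
      rcases eq_or_ne w.1 0 with h0 | h0
      · rw [h0]; simp only [norm_zero, zero_mul]; linarith [hw.2]
      · have hn : 0 < ‖w.1‖ := norm_pos_iff.2 h0
        have hy := hupper w hw (p + (r / 2 / ‖w.1‖) • w.1) (hball (by
          rw [mem_ball_iff_norm, add_sub_cancel_left, norm_smul, Real.norm_of_nonneg (by positivity)]
          rw [div_mul_cancel₀ _ hn.ne']
          exact half_lt_self hr))
        rw [add_sub_cancel_left, inner_smul_right, real_inner_self_eq_norm_sq] at hy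
        have : r / 2 / ‖w.1‖ * ‖w.1‖ ^ 2 = ‖w.1‖ * (r / 2) := by field_simp
        rw [this] at hy
        linarith [hw.2]
    · exact abs_le_max_abs_abs hw.2 ht
  have hCne : C.Nonempty := ⟨(0, c), fun x hx => by
    simpa using hc (Set.mem_image_of_mem G hx), le_rfl⟩
  obtain ⟨w, hw, hmax⟩ := (Metric.isCompact_of_isClosed_isBounded hCcl hCbd).exists_isMaxOn hCne
    continuous_snd.continuousOn
  refine ⟨(innerₛₗ ℝ w.1).toAffineMap + AffineMap.const ℝ (E m) (w.2 - ⟪w.1, p⟫), ?_, ?_⟩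
  · intro x hx
    have := hw.1 x hx
    rw [inner_sub_right] at this
    simp
    linarith
  · intro g' hg'
    have hval : ((innerₛₗ ℝ w.1).toAffineMap + AffineMap.const ℝ (E m) (w.2 - ⟪w.1, p⟫)) p = w.2 := by
      simp
    rw [hval]
    rcases le_or_gt (g' p) c with h | h
    · exact h.trans hw.2
    · let v : E m := (InnerProductSpace.toDual ℝ (E m)).symm g'.linear.toContinuousLinearMap
      have hv : ∀ y, ⟪v, y⟫ = g'.linear y := fun y => by simp [v]
      refine hmax (a := (v, g' p)) ⟨fun x hx => ?_, h.le⟩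
      have := hg' x hx
      simp only [hv]
      have h2 : g'.linear (x - p) = g' x - g' p := by
        simpa using g'.linearMap_vsub x p
      rw [h2]; linarith

/-- The cells of a regular subdivision of a full-dimensional point set cover its convex hull. -/
lemma convexHull_subset_iUnion_isLowerCell (hA : A.Finite) (hspan : affineSpan ℝ A = ⊤) :
    convexHull ℝ A ⊆ ⋃ S ∈ {S | IsLowerCell G A S}, convexHull ℝ S := by
  have hfin : {S | IsLowerCell G A S}.Finite := hA.finite_subsets.subset fun S hS => hS.1
  have hclosed : IsClosed (⋃ S ∈ {S | IsLowerCell G A S}, convexHull ℝ S) :=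
    hfin.isClosed_biUnion fun S hS => (hA.subset hS.1).isClosed_convexHull ℝ
  have hint := (interior_convexHull_nonempty_iff_affineSpan_eq_top (s := A)).2 hspan
  have hcl := (convex_convexHull ℝ A).closure_interior_eq_closure_of_nonempty_interior hint
  refine subset_closure.trans (hcl ▸ hclosed.closure_subset_iff.2 fun p hp => ?_)
  obtain ⟨g, hg, hmax⟩ := exists_affineMap_le_forall_apply_le (G := G) hA hp
  set S := {x ∈ A | g x = G x} with hS
  refine Set.mem_biUnion (isLowerCell_setOf_eq g hg : IsLowerCell G A S) ?_
  by_contra hpS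
  -- A point outside the hull of the contact set could be separated from it, and the minorant
  -- tilted so as to increase its value there.
  obtain ⟨f, u, hfp, hfS⟩ := geometric_hahn_banach_point_closed (convex_convexHull ℝ S)
    ((hA.subset (Set.sep_subset _ _)).isClosed_convexHull ℝ) hpS
  let q : E m →ᵃ[ℝ] ℝ := AffineMap.const ℝ (E m) u - (f : E m →ₗ[ℝ] ℝ).toAffineMap
  have hq : ∀ x, q x = u - f x := fun x => by simp [q]
  obtain ⟨ε, hε, hlt⟩ := exists_pos_forall_mul_lt (hA.subset Set.sdiff_subset : (A \ S).Finite)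
    (fun x => G x - g x) q (fun x hx => sub_pos.2
      (lt_of_le_of_ne (hg x hx.1) fun h => hx.2 ⟨hx.1, h⟩))
  have h := hmax (g + ε • q) fun x hx => by
    simp only [AffineMap.coe_add, AffineMap.coe_smul, Pi.add_apply, Pi.smul_apply, smul_eq_mul]
    by_cases hxS : x ∈ S
    · have := hfS x (subset_convexHull ℝ S hxS)
      rw [hq]
      nlinarith [hg x hx]
    · linarith [hlt x ⟨hx, hxS⟩]
  simp only [AffineMap.coe_add, AffineMap.coe_smul, Pi.add_apply, Pi.smul_apply, smul_eq_mul, hq] at h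
  nlinarith

end Cover

/-! ### Pushing points one at a time -/

section InitialPoints

variable {V : Type*} {n : ℕ}

/-- The first `N` points of a configuration. -/
def initialPoints (b : Fin n → V) (N : ℕ) : Set V := b '' {j | (j : ℕ) < N}

lemma initialPoints_finite (b : Fin n → V) (N : ℕ) : (initialPoints b N).Finite :=
  (Set.toFinite _).image b

lemma initialPoints_mono (b : Fin n → V) {M N : ℕ} (h : M ≤ N) :
    initialPoints b M ⊆ initialPoints b N :=
  Set.image_mono fun _ hj => lt_of_lt_of_le hj h

lemma initialPoints_eq_range (b : Fin n → V) : initialPoints b n = Set.range b := by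
  simp [initialPoints]

lemma initialPoints_succ (b : Fin n → V) (i : Fin n) :
    initialPoints b (i + 1) = insert (b i) (initialPoints b i) := by
  ext x
  simp only [initialPoints, Set.mem_image, Set.mem_ofPred_eq, Set.mem_insert_iff]
  constructor
  · rintro ⟨j, hj, rfl⟩
    rcases (Nat.lt_succ_iff.1 hj).lt_or_eq with h | h
    · exact Or.inr ⟨j, h, rfl⟩
    · exact Or.inl (congrArg b (Fin.ext h))
  · rintro (rfl | ⟨j, hj, rfl⟩)
    · exact ⟨i, Nat.lt_succ_self _, rfl⟩
    · exact ⟨j, Nat.lt_succ_of_lt hj, rfl⟩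

lemma mem_initialPoints {b : Fin n → V} (hinj : Function.Injective b) (i : Fin n) {N : ℕ} :
    b i ∈ initialPoints b N ↔ (i : ℕ) < N := by
  simp [initialPoints, hinj.eq_iff]

end InitialPoints

section Placing

variable {V : Type*} [AddCommGroup V] [Module ℝ V] {n : ℕ}

/-- From the label `r` on, every point is placed above the earlier ones with respect to the heights `G`:
its height exceeds the value there of the affine interpolant of `G` on any affine basis of the ambient
space formed by earlier points. -/
def IsPlacing (G : V → ℝ) (b : Fin n → V) (r : ℕ) : Prop :=
  ∀ i : Fin n, r ≤ (i : ℕ) → ∀ S ⊆ initialPoints b i, AffineIndependent ℝ ((↑) : S → V) →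
    affineSpan ℝ S = ⊤ → ∀ g : V →ᵃ[ℝ] ℝ, (∀ x ∈ S, g x = G x) → g (b i) < G (b i)

variable {G : V → ℝ} {b : Fin n → V} {r N : ℕ} {S : Set V}

lemma affineSpan_initialPoints_eq_top (hspan : affineSpan ℝ (initialPoints b r) = ⊤) (hrN : r ≤ N) :
    affineSpan ℝ (initialPoints b N) = ⊤ :=
  top_le_iff.1 (hspan ▸ affineSpan_mono ℝ (initialPoints_mono b hrN))

/-- The regular subdivision of the first `N` points is a triangulation: a dependent cell would, after
enlarging its part among the earlier points to a spanning cell, put the newest point of the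
dependency on an affine interpolant that the placing condition keeps it above. -/
lemma IsLowerCell.affineIndependent (hinj : Function.Injective b)
    (hind : AffineIndependent ℝ ((↑) : initialPoints b r → V))
    (hspan : affineSpan ℝ (initialPoints b r) = ⊤) (hpl : IsPlacing G b r) (hrN : r ≤ N)
    (hNn : N ≤ n) (hS : IsLowerCell G (initialPoints b N) S) :
    AffineIndependent ℝ ((↑) : S → V) := by
  induction N, hrN using Nat.le_induction generalizing S with
  | base => exact hind.mono hS.1
  | succ N hrN ih =>
    let i : Fin n := ⟨N, hNn⟩
    have hsucc : initialPoints b (N + 1) = insert (b i) (initialPoints b N) := initialPoints_succ b i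
    obtain ⟨hSA, g, hg, hlt⟩ := hS
    have hiN : b i ∉ initialPoints b N := by
      rw [mem_initialPoints hinj]; exact lt_irrefl N
    have hS' : IsLowerCell G (initialPoints b N) (S \ {b i}) := by
      refine ⟨fun x hx => (hsucc ▸ hSA hx.1).resolve_left hx.2, g, fun x hx => hg x hx.1,
        fun x hx hxS => hlt x (initialPoints_mono b N.le_succ hx) fun h => hxS ⟨h, ?_⟩⟩
      rintro rfl
      exact hiN hx
    have hind' := ih (Nat.le_of_succ_le hNn) hS'
    by_cases hiS : b i ∈ S
    · by_cases hispan : b i ∈ affineSpan ℝ (S \ {b i})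
      · exfalso
        obtain ⟨g₁, hg₁, hg₁le, hg₁S⟩ := hS'.exists_le
        obtain ⟨g', hle, hcont, htop⟩ := exists_le_affineSpan_eq_top (initialPoints_finite b N)
          (affineSpan_initialPoints_eq_top hspan hrN) g₁ hg₁le
        have h1 := hpl i hrN _ (Set.sep_subset _ _)
          (ih (Nat.le_of_succ_le hNn) (isLowerCell_setOf_eq g' hle)) htop g' fun x hx => hx.2
        have h2 : g' (b i) = g (b i) := eq_of_mem_affineSpan (fun x hx => by
          rw [hcont x (hS'.1 hx) (hg₁ x hx), hg x hx.1]) hispan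
        rw [h2, hg _ hiS] at h1
        exact lt_irrefl _ h1
      · have := affineIndependent_insert hispan hind'
        rwa [Set.insert_sdiff_singleton, Set.insert_eq_of_mem hiS] at this
    · rwa [Set.sdiff_singleton_eq_self hiS] at hind'

/-- Cells persist when further points are placed. -/
lemma IsLowerCell.persist (hinj : Function.Injective b)
    (hind : AffineIndependent ℝ ((↑) : initialPoints b r → V))
    (hspan : affineSpan ℝ (initialPoints b r) = ⊤) (hpl : IsPlacing G b r) (hrN : r ≤ N)
    {M : ℕ} (hNM : N ≤ M) (hMn : M ≤ n) (hS : IsLowerCell G (initialPoints b N) S) :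
    IsLowerCell G (initialPoints b M) S := by
  induction M, hNM using Nat.le_induction with
  | base => exact hS
  | succ M hNM ih =>
    let i : Fin n := ⟨M, hMn⟩
    have hsucc : initialPoints b (M + 1) = insert (b i) (initialPoints b M) := initialPoints_succ b i
    have hrM := hrN.trans hNM
    obtain ⟨g, hg, hle, -⟩ := (ih (Nat.le_of_succ_le hMn)).exists_le
    obtain ⟨g', hle', hcont, htop⟩ := exists_le_affineSpan_eq_top (initialPoints_finite b M)
      (affineSpan_initialPoints_eq_top hspan hrM) g hle
    have hTind := IsLowerCell.affineIndependent hinj hind hspan hpl hrM (Nat.le_of_succ_le hMn)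
      (isLowerCell_setOf_eq g' hle')
    have hi := hpl i hrM _ (Set.sep_subset _ _) hTind htop g' fun x hx => hx.2
    refine IsLowerCell.of_subset (S := {x ∈ initialPoints b M | g' x = G x})
      (initialPoints_finite b _) ?_ hTind fun x hx => ?_
    · refine ⟨fun x hx => initialPoints_mono b M.le_succ hx.1, g', fun x hx => hx.2,
        fun x hx hxT => ?_⟩
      rw [hsucc] at hx
      rcases hx with rfl | hx
      · exact hi
      · exact lt_of_le_of_ne (hle' x hx) fun h => hxT ⟨hx, h⟩
    · have hxM := (ih (Nat.le_of_succ_le hMn)).1 hx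
      exact ⟨hxM, hcont x hxM (hg x hx)⟩

/-- Placing a new point `b i` beyond a face `S` of the hull of the earlier points creates the cell
spanned by `S` and `b i`. -/
lemma isLowerCell_insert (hinj : Function.Injective b)
    (hind : AffineIndependent ℝ ((↑) : initialPoints b r → V))
    (hspan : affineSpan ℝ (initialPoints b r) = ⊤) (hpl : IsPlacing G b r) {i : Fin n}
    (hri : r ≤ i) (hSi : S ⊆ initialPoints b i) (hSind : AffineIndependent ℝ ((↑) : S → V))
    (u : V →ᵃ[ℝ] ℝ) (hu : ∀ x ∈ S, u x = 0) (hu' : ∀ x ∈ initialPoints b i, x ∉ S → u x < 0)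
    (hui : 0 < u (b i)) : IsLowerCell G (initialPoints b (i + 1)) (insert (b i) S) := by
  have hcell : IsLowerCell G (initialPoints b i) S :=
    isLowerCell_of_face (initialPoints_finite b i) hSi hSind u hu hu'
  obtain ⟨-, g, hg, hlt⟩ := hcell.persist hinj hind hspan hpl hri i.val.le_succ i.2
  have hiS : b i ∉ S := fun h => by
    have := (mem_initialPoints hinj i).1 (hSi h)
    exact lt_irrefl _ this
  have hi : g (b i) < G (b i) := hlt _ (by rw [mem_initialPoints hinj]; exact Nat.lt_succ_self _) hiS
  -- Add the multiple of `u` that raises the value at `b i` to `G (b i)`.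
  set c := (G (b i) - g (b i)) / u (b i) with hc
  have hc0 : 0 < c := div_pos (sub_pos.2 hi) hui
  refine ⟨?_, g + c • u, ?_, ?_⟩
  · rw [initialPoints_succ]
    exact Set.insert_subset_insert hSi
  · rintro x (rfl | hx)
    · simp [hc, hui.ne']
    · simp [hg x hx, hu x hx]
  · intro x hx hxS
    simp only [Set.mem_insert_iff, not_or] at hxS
    have h1 := hlt x hx hxS.2
    rw [initialPoints_succ] at hx
    have h2 := hu' x (hx.resolve_left hxS.1) hxS.2
    simp only [AffineMap.coe_add, AffineMap.coe_smul, Pi.add_apply, Pi.smul_apply, smul_eq_mul]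
    nlinarith

end Placing

/-! ### Stereographic projections of smooth strictly convex bodies -/

section Body

variable {m : ℕ} {K : Set (E m)} {c v : E m}

lemma IsSmoothStrictlyConvexBody.inner_lt (hK : IsSmoothStrictlyConvexBody K)
    (hc : c ∈ K) (hv : IsOuterNormal K c v) {x : E m} (hx : x ∈ K) (hxc : x ≠ c) :
    ⟪v, x⟫ < ⟪v, c⟫ := by
  refine lt_of_le_of_ne (hv.2 x hx) fun heq => ?_
  have hmid : (1 / 2 : ℝ) • x + (1 / 2 : ℝ) • c ∈ interior K :=
    hK.strictConvex hx hc hxc (by norm_num) (by norm_num) (by norm_num)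
  set y := (1 / 2 : ℝ) • x + (1 / 2 : ℝ) • c with hy
  have hyv : ⟪v, y⟫ = ⟪v, c⟫ := by
    rw [hy, inner_add_right, inner_smul_right, inner_smul_right, heq]; ring
  -- Moving from the interior point `y` in the direction `v` increases the functional.
  have htend : Filter.Tendsto (fun s : ℝ => y + s • v) (nhdsWithin 0 (Set.Ioi 0)) (nhds y) := by
    have : Filter.Tendsto (fun s : ℝ => y + s • v) (nhds 0) (nhds (y + (0 : ℝ) • v)) :=
      Continuous.tendsto (by fun_prop) 0
    rw [zero_smul, add_zero] at this
    exact this.mono_left nhdsWithin_le_nhds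
  obtain ⟨s, hs, hs0⟩ := ((htend.eventually (isOpen_interior.mem_nhds hmid)).and
    self_mem_nhdsWithin).exists
  have h1 := hv.2 _ (interior_subset hs)
  rw [inner_add_right, inner_smul_right, hyv] at h1
  have h2 : 0 < ⟪v, v⟫ := real_inner_self_pos.2 hv.1
  have : 0 < s * ⟪v, v⟫ := mul_pos hs0 h2
  linarith

/-- At a smooth boundary point, every direction pointing strictly to the inner side of the tangent
hyperplane leads into the interior. -/
lemma IsSmoothStrictlyConvexBody.exists_add_smul_mem_interior (hK : IsSmoothStrictlyConvexBody K)
    (hc : c ∈ frontier K) (hv : IsOuterNormal K c v) {y : E m} (hy : ⟪v, y⟫ < 0) :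
    ∃ s > (0 : ℝ), c + s • y ∈ interior K := by
  by_contra! hdisj
  have hcK : c ∈ K := hK.isCompact.isClosed.frontier_subset hc
  have hconv : Convex ℝ K := hK.strictConvex.convex
  have hray : Convex ℝ ((fun s : ℝ => c + s • y) '' Set.Ioi 0) := by
    rw [show (fun s : ℝ => c + s • y) = AffineMap.lineMap c (c + y) by
      ext1 s; simp [AffineMap.lineMap_apply, add_comm]]
    exact (convex_Ioi (0 : ℝ)).affine_image _
  obtain ⟨f, u, hfK, hfray⟩ := geometric_hahn_banach_open hconv.interior isOpen_interior hray (by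
    rw [Set.disjoint_right]
    rintro _ ⟨s, hs, rfl⟩
    exact hdisj s hs)
  have hfK' : ∀ x ∈ K, f x ≤ u := by
    have hcl : K ⊆ closure (interior K) := by
      rw [hconv.closure_interior_eq_closure_of_nonempty_interior hK.interior_nonempty]
      exact subset_closure
    intro x hx
    have : closure (interior K) ⊆ {x | f x ≤ u} :=
      closure_minimal (fun x hx => (hfK x hx).le) (isClosed_le f.continuous continuous_const)
    exact this (hcl hx)
  have hfc : f c = u := by
    refine le_antisymm (hfK' c hcK) ?_
    have : Filter.Tendsto (fun s : ℝ => f (c + s • y)) (nhdsWithin 0 (Set.Ioi 0)) (nhds (f c)) := by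
      have : Filter.Tendsto (fun s : ℝ => f (c + s • y)) (nhds 0) (nhds (f (c + (0 : ℝ) • y))) :=
        Continuous.tendsto (by fun_prop) 0
      rw [zero_smul, add_zero] at this
      exact this.mono_left nhdsWithin_le_nhds
    refine ge_of_tendsto this ?_
    filter_upwards [self_mem_nhdsWithin] with s hs
    exact hfray _ ⟨s, hs, rfl⟩
  have hfy : 0 ≤ f y := by
    have := hfray _ ⟨1, Set.mem_Ioi.2 one_pos, rfl⟩
    simp only [one_smul, map_add] at this
    linarith
  obtain ⟨a, ha⟩ := hK.interior_nonempty
  have hfa : f (a - c) < 0 := by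
    rw [map_sub, hfc]; linarith [hfK a ha]
  let w : E m := (InnerProductSpace.toDual ℝ (E m)).symm f
  have hw : ∀ x, ⟪w, x⟫ = f x := fun x => by simp [w]
  have hw0 : w ≠ 0 := by
    intro h
    have := hw (a - c)
    rw [h, inner_zero_left] at this
    linarith
  -- The separating functional supports `K` at `c`, so it is the tangent functional.
  obtain ⟨H, -, hH⟩ := hK.smooth c hc
  have hEq : hyperplane w ⟪w, c⟫ = hyperplane v ⟪v, c⟫ :=
    (hH _ ⟨w, ⟨hw0, fun x hx => by rw [hw, hw, hfc]; exact hfK' x hx⟩, rfl⟩).trans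
      (hH _ ⟨v, hv, rfl⟩).symm
  have hker : ∀ x, ⟪v, x⟫ = 0 → f x = 0 := by
    intro x hx
    have hmem : c + x ∈ hyperplane v ⟪v, c⟫ := by simp [hyperplane, inner_add_right, hx]
    rw [← hEq] at hmem
    simpa [hyperplane, inner_add_right, hw] using hmem
  have hva : ⟪v, a - c⟫ < 0 := by
    refine lt_of_le_of_ne ?_ fun h => hfa.ne (hker _ h)
    rw [inner_sub_right]; linarith [hv.2 a (interior_subset ha)]
  have h0 := hker (y - (⟪v, y⟫ / ⟪v, a - c⟫) • (a - c)) (by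
    rw [inner_sub_right, inner_smul_right, div_mul_cancel₀ _ hva.ne, sub_self])
  rw [map_sub, map_smul, smul_eq_mul] at h0
  have : ⟪v, y⟫ / ⟪v, a - c⟫ * f (a - c) < 0 := mul_neg_of_pos_of_neg (div_pos_of_neg_of_neg hy hva) hfa
  linarith

/-- A ray from a smooth boundary point `c` of `K` to the inner side meets `K` in a segment. The length
of this segment is recorded by its inverse `r`. -/
lemma IsSmoothStrictlyConvexBody.exists_ray (hK : IsSmoothStrictlyConvexBody K)
    (hc : c ∈ frontier K) (hv : IsOuterNormal K c v) {y : E m} (hy : ⟪v, y⟫ < 0) :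
    ∃ r : ℝ, 0 < r ∧ ∀ s > (0 : ℝ), (c + s • y ∈ K ↔ r ≤ s⁻¹) ∧ (c + s • y ∈ frontier K ↔ r = s⁻¹) := by
  have hcK : c ∈ K := hK.isCompact.isClosed.frontier_subset hc
  have hy0 : y ≠ 0 := by rintro rfl; simp at hy
  have hcont : Continuous fun s : ℝ => c + s • y := by fun_prop
  obtain ⟨s₀, hs₀, hs₀K⟩ := hK.exists_add_smul_mem_interior hc hv hy
  have hcompact : IsCompact ((fun s : ℝ => c + s • y) ⁻¹' K) := by
    have hemb : Topology.IsClosedEmbedding fun s : ℝ => c + s • y :=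
      (Homeomorph.addLeft c).isClosedEmbedding.comp (isClosedEmbedding_smul_left hy0)
    exact hemb.isCompact_preimage hK.isCompact
  have hs₀K' : s₀ ∈ (fun s : ℝ => c + s • y) ⁻¹' K := interior_subset (s := K) hs₀K
  obtain ⟨R, hRK, hR⟩ := hcompact.exists_isMaxOn ⟨s₀, hs₀K'⟩ continuous_id.continuousOn
  have hR : ∀ s, c + s • y ∈ K → s ≤ R := fun s hs => hR hs
  have hR0 : 0 < R := hs₀.trans_le (hR s₀ (interior_subset hs₀K))
  have hint : ∀ s, 0 < s → s < R → c + s • y ∈ interior K := by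
    intro s hs hsR
    have hne : c ≠ c + R • y := by simp [hR0.ne', hy0]
    have := hK.strictConvex hcK hRK hne (a := 1 - s / R) (b := s / R)
      (sub_pos.2 ((div_lt_one hR0).2 hsR)) (div_pos hs hR0) (by ring)
    convert this using 1
    rw [smul_add, smul_smul, div_mul_cancel₀ _ hR0.ne', ← add_assoc, ← add_smul]
    simp
  have hfr : c + R • y ∉ interior K := by
    intro hmem
    have hev := (hcont.tendsto R).eventually (isOpen_interior.mem_nhds hmem)
    obtain ⟨s, hs, hsR⟩ := ((hev.filter_mono nhdsWithin_le_nhds).and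
      (self_mem_nhdsWithin (a := R) (s := Set.Ioi R))).exists
    exact absurd (hR s (interior_subset hs)) (not_le.2 hsR)
  refine ⟨R⁻¹, inv_pos.2 hR0, fun s hs => ⟨?_, ?_⟩⟩
  · rw [inv_le_inv₀ hR0 hs]
    refine ⟨hR s, fun h => ?_⟩
    rcases h.lt_or_eq with h | rfl
    · exact interior_subset (hint s hs h)
    · exact hRK
  · rw [hK.isCompact.isClosed.frontier_eq, inv_inj]
    constructor
    · rintro ⟨h1, h2⟩
      by_contra hne
      exact h2 (hint s hs (lt_of_le_of_ne (hR s h1) fun h => hne h.symm))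
    · rintro rfl
      exact ⟨hRK, hfr⟩

end Body

namespace StereographicProjection

variable {m : ℕ} {K : Set (E (m + 1))} (σ : StereographicProjection K)

/-- The chart of a stereographic projection, with the center as origin and rescaled so that its values
point to the inner side of the tangent hyperplane. -/
lemma exists_direction : ∃ (v : E (m + 1)) (D : E m →ᵃ[ℝ] E (m + 1)),
    IsOuterNormal K σ.center v ∧ (∀ p, ⟪v, D p⟫ = -1) ∧ Function.Injective D ∧
    (∀ y, ⟪v, y⟫ = -1 → ∃ p, D p = y) ∧
    ∀ p, ∀ s : ℝ, s ≠ 0 → σ.proj (σ.center + s • D p) = p := by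
  obtain ⟨v, t, hv, ht, hrange⟩ := σ.range_chart
  set τ := t - ⟪v, σ.center⟫ with hτ
  have hτ0 : τ ≠ 0 := sub_ne_zero.2 ht
  let D : E m →ᵃ[ℝ] E (m + 1) := (-τ⁻¹) • (σ.chart - AffineMap.const ℝ _ σ.center)
  have hD : ∀ p, D p = (-τ⁻¹) • (σ.chart p - σ.center) := fun p => rfl
  have hchart : ∀ p, σ.chart p = σ.center - τ • D p := by
    intro p
    rw [hD, smul_smul]
    simp [hτ0]
  have hvD : ∀ p, ⟪v, D p⟫ = -1 := by
    intro p
    have hp : ⟪v, σ.chart p⟫ = t := by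
      have : σ.chart p ∈ hyperplane v t := hrange ▸ Set.mem_range_self p
      exact this
    rw [hD, inner_smul_right, inner_sub_right, hp, ← hτ]
    field_simp
  have hinj : Function.Injective D := by
    intro p q hpq
    apply σ.chart_injective
    rw [hchart, hchart, hpq]
  refine ⟨v, D, hv, hvD, hinj, ?_, ?_⟩
  · intro y hy
    have hmem : σ.center - τ • y ∈ Set.range σ.chart := by
      rw [hrange]
      simp only [hyperplane, Set.mem_ofPred_eq, inner_sub_right, inner_smul_right, hy]
      rw [hτ]; ring
    obtain ⟨p, hp⟩ := hmem
    refine ⟨p, ?_⟩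
    rw [hchart, sub_right_inj] at hp
    exact smul_right_injective _ hτ0 hp
  · intro p s hs
    have hiff : ∀ p', σ.chart p' ∈ line[ℝ, σ.center, σ.center + s • D p] ↔ p' = p := by
      intro p'
      rw [mem_affineSpan_pair_iff_exists_lineMap_eq]
      simp only [AffineMap.lineMap_apply, vsub_eq_sub, add_sub_cancel_left, vadd_eq_add, smul_smul]
      constructor
      · rintro ⟨r, hr⟩
        rw [hchart, add_comm _ σ.center, sub_eq_add_neg, add_right_inj] at hr
        have h := congrArg (fun y => ⟪v, y⟫) hr
        simp only [inner_smul_right, inner_neg_right, hvD] at h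
        have hrs : r * s = -τ := by linarith
        rw [hrs, ← neg_smul] at hr
        exact (hinj (smul_right_injective _ (neg_ne_zero.2 hτ0) hr)).symm
      · rintro rfl
        refine ⟨-τ / s, ?_⟩
        rw [div_mul_cancel₀ _ hs, hchart, neg_smul]
        abel
    have := Classical.epsilon_spec (p := fun p' => σ.chart p' ∈ line[ℝ, σ.center, σ.center + s • D p])
      ⟨p, (hiff p).2 rfl⟩
    exact (hiff _).1 this

/-- Every affine function of `p` is the pullback along `D` of a linear functional, as the image of `D`
lies in a hyperplane that avoids the origin. -/
lemma exists_inner_eq {v : E (m + 1)} {D : E m →ᵃ[ℝ] E (m + 1)} (hvD : ∀ p, ⟪v, D p⟫ = -1)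
    (hinj : Function.Injective D) (g : E m →ᵃ[ℝ] ℝ) : ∃ w : E (m + 1), ∀ p, ⟪w, D p⟫ = g p := by
  let Φ : E m × ℝ →ₗ[ℝ] E (m + 1) := D.linear.coprod ((LinearMap.id : ℝ →ₗ[ℝ] ℝ).smulRight (D 0))
  have hΦ : ∀ y z, Φ (y, z) = D.linear y + z • D 0 := fun y z => by simp [Φ]
  have hlin : ∀ y, D.linear y = D y - D 0 := fun y => by
    simpa using D.linearMap_vsub y 0
  have hker : LinearMap.ker Φ = ⊥ := by
    rw [LinearMap.ker_eq_bot']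
    rintro ⟨y, z⟩ h
    rw [hΦ, hlin] at h
    have hz := congrArg (fun y => ⟪v, y⟫) h
    simp only [inner_add_right, inner_sub_right, inner_smul_right, hvD, inner_zero_right] at hz
    have hz : z = 0 := by linarith
    rw [hz, zero_smul, add_zero, sub_eq_zero] at h
    rw [hz, hinj h]; rfl
  obtain ⟨Ψ, hΨ⟩ := LinearMap.exists_leftInverse_of_injective Φ hker
  let f : E (m + 1) →ₗ[ℝ] ℝ :=
    (g.linear.coprod ((LinearMap.id : ℝ →ₗ[ℝ] ℝ).smulRight (g 0))) ∘ₗ Ψ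
  refine ⟨(InnerProductSpace.toDual ℝ (E (m + 1))).symm f.toContinuousLinearMap, fun p => ?_⟩
  have hp : D p = Φ (p, 1) := by rw [hΦ, hlin]; simp
  have hΨp : Ψ (D p) = (p, 1) := by rw [hp]; exact LinearMap.congr_fun hΨ (p, 1)
  have hg : g.linear p = g p - g 0 := by simpa using g.linearMap_vsub p 0
  simp [f, hΨp, hg]

/-- A stereographic projection turns the body into the region above the graph of a positive function
`G`: its spheres and balls are the sets where `G` is equal to, or at most, a given nonzero affine
function. -/
theorem exists_height (hK : IsSmoothStrictlyConvexBody K) :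
    ∃ G : E m → ℝ, (∀ p, 0 < G p) ∧
      (∀ g : E m →ᵃ[ℝ] ℝ, g ≠ 0 → ∃ H, IsHyperplane H ∧ σ.center ∉ H ∧
        σ.sphere H = {p | G p = g p} ∧ σ.ball H = {p | G p ≤ g p}) ∧
      (∀ H, IsHyperplane H → σ.center ∉ H → ∃ g : E m →ᵃ[ℝ] ℝ,
        σ.sphere H = {p | G p = g p} ∧ σ.ball H = {p | G p ≤ g p}) := by
  obtain ⟨v, D, hv, hvD, hinj, hsurj, hproj⟩ := σ.exists_direction
  have hcl := hK.isCompact.isClosed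
  have hcK : σ.center ∈ K := hcl.frontier_subset σ.center_mem
  choose G hG0 hG using fun p => hK.exists_ray σ.center_mem hv (y := D p) (by rw [hvD]; norm_num)
  have hrep : ∀ x ∈ K, x ≠ σ.center → ∃ p, ∃ s : ℝ, 0 < s ∧ x = σ.center + s • D p := by
    intro x hx hxc
    have hlt := hK.inner_lt hcK hv hx hxc
    have hs : 0 < ⟪v, σ.center⟫ - ⟪v, x⟫ := sub_pos.2 hlt
    obtain ⟨p, hp⟩ := hsurj ((⟪v, σ.center⟫ - ⟪v, x⟫)⁻¹ • (x - σ.center)) (by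
      rw [inner_smul_right, inner_sub_right]; field_simp; ring)
    refine ⟨p, _, hs, ?_⟩
    rw [hp, smul_smul, mul_inv_cancel₀ hs.ne', one_smul, add_sub_cancel]
  have key : ∀ (H : Set (E (m + 1))) (g : E m →ᵃ[ℝ] ℝ), σ.center ∉ H →
      (∀ p, ∀ s > (0 : ℝ), σ.center + s • D p ∈ H ↔ g p = s⁻¹) →
      σ.sphere H = {p | G p = g p} ∧ σ.ball H = {p | G p ≤ g p} := by
    intro H g hcH hgH
    constructor <;> ext p <;> constructor
    · rintro ⟨x, ⟨hxH, hxK⟩, rfl⟩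
      obtain ⟨p, s, hs, rfl⟩ := hrep x (hcl.frontier_subset hxK) (fun h => hcH (h ▸ hxH))
      rw [hproj p s hs.ne']
      exact (((hG p s hs).2).1 hxK).trans ((hgH p s hs).1 hxH).symm
    · intro hp
      have hs : 0 < (G p)⁻¹ := inv_pos.2 (hG0 p)
      refine ⟨σ.center + (G p)⁻¹ • D p, ⟨(hgH p _ hs).2 ?_, ((hG p _ hs).2).2 ?_⟩, hproj p _ hs.ne'⟩
      · rw [inv_inv]; exact hp.symm
      · rw [inv_inv]
    · rintro ⟨x, ⟨hxH, hxK⟩, rfl⟩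
      obtain ⟨p, s, hs, rfl⟩ := hrep x hxK (fun h => hcH (h ▸ hxH))
      rw [hproj p s hs.ne']
      exact (((hG p s hs).1).1 hxK).trans ((hgH p s hs).1 hxH).ge
    · intro hp
      have hs : 0 < (g p)⁻¹ := inv_pos.2 ((hG0 p).trans_le hp)
      refine ⟨σ.center + (g p)⁻¹ • D p, ⟨(hgH p _ hs).2 ?_, ((hG p _ hs).1).2 ?_⟩, hproj p _ hs.ne'⟩
      · rw [inv_inv]
      · rw [inv_inv]; exact hp
  refine ⟨G, hG0, ?_, ?_⟩
  · intro g hg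
    obtain ⟨w, hw⟩ := exists_inner_eq hvD hinj g
    have hcH : σ.center ∉ hyperplane w (⟪w, σ.center⟫ + 1) := by simp [hyperplane]
    refine ⟨hyperplane w (⟪w, σ.center⟫ + 1), ⟨w, _, ?_, rfl⟩, hcH, key _ g hcH ?_⟩
    · rintro rfl
      exact hg (by ext p; simpa using (hw p).symm)
    · intro p s hs
      simp only [hyperplane, Set.mem_ofPred_eq, inner_add_right, inner_smul_right, hw, add_right_inj]
      rw [← mul_eq_one_iff_eq_inv₀ hs.ne', mul_comm]
  · rintro H ⟨w, t, -, rfl⟩ hcH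
    have hne : t - ⟪w, σ.center⟫ ≠ 0 := fun h => hcH (sub_eq_zero.1 h).symm
    refine ⟨((t - ⟪w, σ.center⟫)⁻¹ • (innerₛₗ ℝ w)).toAffineMap.comp D, key _ _ hcH ?_⟩
    intro p s hs
    simp only [hyperplane, Set.mem_ofPred_eq, inner_add_right, inner_smul_right, AffineMap.comp_apply,
      LinearMap.coe_toAffineMap, LinearMap.smul_apply, innerₛₗ_apply_apply, smul_eq_mul]
    rw [← mul_eq_one_iff_eq_inv₀ hs.ne', mul_assoc, inv_mul_eq_one₀ hne]
    constructor <;> intro h <;> linarith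



end StereographicProjection

/-! ### Points in general position -/

lemma affineSpan_eq_top_iff_ncard_eq {m : ℕ} {S : Set (E m)} (hfin : S.Finite)
    (hS : AffineIndependent ℝ ((↑) : S → E m)) : affineSpan ℝ S = ⊤ ↔ S.ncard = m + 1 := by
  have := hfin.fintype
  have h := hS.affineSpan_eq_top_iff_card_eq_finrank_add_one
  rwa [Subtype.range_coe, finrank_euclideanSpace_fin, ← Nat.card_eq_fintype_card,
    Nat.card_coe_set_eq] at h

/-- The Riesz representation of the linear part of an affine function. -/
lemma exists_inner_add_eq {m : ℕ} (q : E m →ᵃ[ℝ] ℝ) : ∃ v : E m, ∀ x, q x = ⟪v, x⟫ + q 0 := by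
  refine ⟨(InnerProductSpace.toDual ℝ (E m)).symm q.linear.toContinuousLinearMap, fun x => ?_⟩
  have : q.linear x = q x - q 0 := by simpa using q.linearMap_vsub x 0
  simp [this]

section GeneralPosition

variable {d n : ℕ} {a : Fin n → E d}

lemma GeneralPosition.affineSpan_image_eq_top (hgen : GeneralPosition a) {I : Finset (Fin n)}
    (hI : d + 1 ≤ I.card) : affineSpan ℝ (a '' I) = ⊤ := by
  obtain ⟨J, hJI, hJ⟩ := Finset.exists_subset_card_eq hI
  suffices h : affineSpan ℝ (a '' J) = ⊤ from
    top_le_iff.1 (h ▸ affineSpan_mono ℝ (Set.image_mono (Finset.coe_subset.2 hJI)))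
  by_contra hne
  obtain ⟨p, -, hp⟩ := SetLike.exists_of_lt (lt_top_iff_ne_top.2 hne)
  obtain ⟨q, hq0, hq1⟩ := exists_affineMap_eq_zero_and_eq_one hp
  obtain ⟨v, hv⟩ := exists_inner_add_eq q
  obtain ⟨j, hj⟩ := Finset.card_pos.1 (by omega : 0 < J.card)
  have hqJ : ∀ i ∈ J, q (a i) = 0 := fun i hi => hq0 _ (Set.mem_image_of_mem a hi)
  refine hgen J hJ (hyperplane v (-q 0)) ⟨v, _, ?_, rfl⟩ fun i hi => ?_
  · rintro rfl
    have h1 := hv (a j)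
    have h2 := hv p
    rw [hqJ j hj, inner_zero_left] at h1
    rw [hq1, inner_zero_left, ← h1] at h2
    exact one_ne_zero h2
  · have := hv (a i)
    rw [hqJ i hi] at this
    show ⟪v, a i⟫ = -q 0
    linarith

lemma GeneralPosition.affineIndependent (hgen : GeneralPosition a) (hn : d + 1 ≤ n)
    {I : Finset (Fin n)} (hI : I.card ≤ d + 1) : AffineIndependent ℝ (fun i : I => a i) := by
  obtain ⟨J, hIJ, -, hJ⟩ := Finset.exists_subsuperset_card_eq (Finset.subset_univ I) hI (by simpa)
  have hJind : AffineIndependent ℝ (fun i : J => a i) := by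
    rw [affineIndependent_iff_finrank_vectorSpan_eq ℝ _ (n := d) (by simpa using hJ)]
    have htop := hgen.affineSpan_image_eq_top hJ.ge
    have hrange : Set.range (fun i : J => a i) = a '' J := by
      ext x; simp
    rw [hrange, ← direction_affineSpan, htop, AffineSubspace.direction_top, finrank_top,
      finrank_euclideanSpace_fin]
  let e : I ↪ J := ⟨fun i => ⟨i, hIJ i.2⟩, fun i j h => Subtype.ext (Subtype.mk.inj h)⟩
  exact hJind.comp_embedding e

lemma GeneralPosition.card_le (hgen : GeneralPosition a) {I : Finset (Fin n)} (l : E d →ᵃ[ℝ] ℝ)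
    (hl : ∀ i ∈ I, l (a i) = 0) {x : E d} (hx : l x ≠ 0) : I.card ≤ d := by
  by_contra! h
  refine hx (eq_of_mem_affineSpan (T := a '' I) (g' := 0) ?_
    (hgen.affineSpan_image_eq_top h ▸ AffineSubspace.mem_top ℝ _ x))
  rintro _ ⟨i, hi, rfl⟩
  exact hl i hi

end GeneralPosition

/-! ### Faces of neighborly polytopes -/

section Neighborliness

variable {d n k : ℕ} {a : Fin n → E d} {P : Set (E d)}

lemma IsPolytope.convexHull_extremePoints (hP : IsPolytope P) :
    convexHull ℝ (P.extremePoints ℝ) = P := by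
  obtain ⟨F, rfl⟩ := hP
  have h := closure_convexHull_extremePoints (F.finite_toSet.isCompact_convexHull ℝ)
    (convex_convexHull ℝ (F : Set (E d)))
  rwa [((F.finite_toSet.subset extremePoints_convexHull_subset).isClosed_convexHull
    ℝ).closure_eq] at h

/-- A proper set of `k` vertices of a `k`-neighborly polytope is cut out by a supporting
hyperplane. -/
lemma IsNeighborlyPolytope.exists_face (hP : IsNeighborlyPolytope k P)
    (hvert : P.extremePoints ℝ = Set.range a) (ha : Function.Injective a) {I : Finset (Fin n)}
    (hI : I.card = k) :
    ∃ l : E d →ᵃ[ℝ] ℝ, (∀ i ∈ I, l (a i) = 0) ∧ ∀ i ∉ I, l (a i) < 0 := by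
  classical
  rcases I.eq_empty_or_nonempty with rfl | ⟨j, hj⟩
  · exact ⟨AffineMap.const ℝ _ (-1), by simp, by simp⟩
  have hext : ∀ i, a i ∈ P.extremePoints ℝ := fun i => hvert ▸ Set.mem_range_self i
  have hexp := hP.2 (I.image a) (by
    rw [hvert, Finset.coe_image]; exact Set.image_subset_range _ _) (by
    rw [Finset.card_image_of_injective _ ha, hI])
  rw [Finset.coe_image] at hexp
  have hmem : ∀ i ∈ I, a i ∈ convexHull ℝ (a '' I) := fun i hi =>
    subset_convexHull ℝ _ (Set.mem_image_of_mem a hi)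
  obtain ⟨f, hf⟩ := hexp ⟨a j, hmem j hj⟩
  have hjf := hmem j hj
  rw [hf] at hjf
  refine ⟨(f : E d →ₗ[ℝ] ℝ).toAffineMap - AffineMap.const ℝ _ (f (a j)), fun i hi => ?_,
    fun i hi => ?_⟩
  · have hif := hmem i hi
    rw [hf] at hif
    simpa [sub_eq_zero] using le_antisymm (hjf.2 _ hif.1) (hif.2 _ hjf.1)
  · have hle := hjf.2 _ (hext i).1
    have hne : f (a i) ≠ f (a j) := by
      intro heq
      have hi' : a i ∈ convexHull ℝ (a '' I) := by
        rw [hf]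
        exact ⟨(hext i).1, fun y hy => heq ▸ hjf.2 y hy⟩
      -- A vertex lying in the face would be an extreme point of it, so one of its generators.
      have hsub : convexHull ℝ (a '' I) ⊆ P := hf ▸ Set.sep_subset _ _
      have := extremePoints_convexHull_subset
        (inter_extremePoints_subset_extremePoints_of_subset hsub ⟨hi', hext i⟩)
      obtain ⟨i', hi'I, hi'⟩ := this
      exact hi (ha hi' ▸ hi'I)
    simpa using lt_of_le_of_ne hle hne

end Neighborliness

/-! ### Liftings -/

section Lifting

variable {d n : ℕ}

/-- The vertical projection `ℝᵈ⁺¹ → ℝᵈ`. -/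
def dropLast (d : ℕ) : E (d + 1) →ₗ[ℝ] E d where
  toFun x := WithLp.toLp 2 fun j => x j.castSucc
  map_add' _ _ := rfl
  map_smul' _ _ := rfl

/-- The height of a point of `ℝᵈ⁺¹`. -/
def height (d : ℕ) : E (d + 1) →ₗ[ℝ] ℝ where
  toFun x := x (Fin.last d)
  map_add' _ _ := rfl
  map_smul' _ _ := rfl

@[simp] lemma dropLast_apply (x : E (d + 1)) (j : Fin d) : dropLast d x j = x j.castSucc := rfl

lemma height_apply (x : E (d + 1)) : height d x = x (Fin.last d) := rfl

@[simp] lemma dropLast_liftPoint (x : E d) (h : ℝ) : dropLast d (liftPoint x h) = x := by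
  ext j; simp [liftPoint]

lemma eq_of_dropLast_eq_of_height_eq {x y : E (d + 1)} (h : dropLast d x = dropLast d y)
    (h' : height d x = height d y) : x = y := by
  ext j
  refine Fin.lastCases h' (fun j => ?_) j
  exact congrArg (fun z : E d => z j) h

/-- The affine function measuring the height of a point above the graph of `q`. -/
def aboveGraph (q : E d →ᵃ[ℝ] ℝ) : E (d + 1) →ᵃ[ℝ] ℝ :=
  (height d).toAffineMap - q.comp (dropLast d).toAffineMap

@[simp] lemma aboveGraph_apply (q : E d →ᵃ[ℝ] ℝ) (x : E (d + 1)) :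
    aboveGraph q x = height d x - q (dropLast d x) := rfl

/-- The graph of an affine function is a hyperplane, with a normal vector with positive last
coordinate. -/
lemma exists_graph_eq_hyperplane (q : E d →ᵃ[ℝ] ℝ) :
    ∃ (v : E (d + 1)) (t : ℝ), 0 < v (Fin.last d) ∧ ∀ x, aboveGraph q x = ⟪v, x⟫ - t := by
  obtain ⟨v, hv⟩ := exists_inner_add_eq (aboveGraph q)
  refine ⟨v, -aboveGraph q 0, ?_, fun x => by rw [hv x]; ring⟩
  have h1 := hv (EuclideanSpace.single (Fin.last d) 1)
  have h2 : dropLast d (EuclideanSpace.single (Fin.last d) (1 : ℝ)) = 0 := by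
    ext j
    simp
  have h3 : height d (EuclideanSpace.single (Fin.last d) (1 : ℝ)) = 1 := by
    simp [height_apply]
  simp only [aboveGraph_apply, h2, h3, map_zero, EuclideanSpace.inner_single_right] at h1
  simp at h1
  linarith

/-- Points of a graph whose projections span the base space span the graph. -/
lemma mem_affineSpan_of_graph {T : Set (E (d + 1))} (q : E d →ᵃ[ℝ] ℝ)
    (hT : ∀ x ∈ T, aboveGraph q x = 0) (hspan : affineSpan ℝ (dropLast d '' T) = ⊤)
    {x : E (d + 1)} : x ∈ affineSpan ℝ T ↔ aboveGraph q x = 0 := by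
  refine ⟨fun hx => by simpa using eq_of_mem_affineSpan (g := aboveGraph q) (g' := 0) hT hx,
    fun hx => ?_⟩
  have h1 : dropLast d x ∈ (affineSpan ℝ T).map (dropLast d).toAffineMap := by
    rw [AffineSubspace.map_span, LinearMap.coe_toAffineMap, hspan]
    exact AffineSubspace.mem_top ℝ _ _
  obtain ⟨y, hy, hyx⟩ := h1
  have hy0 : aboveGraph q y = 0 := by
    simpa using eq_of_mem_affineSpan (g := aboveGraph q) (g' := 0) hT hy
  have hyx : dropLast d y = dropLast d x := hyx
  rw [aboveGraph_apply, sub_eq_zero] at hx hy0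
  rw [eq_of_dropLast_eq_of_height_eq hyx.symm (by rw [hx, hy0, hyx])]
  exact hy

variable {a : Fin n → E d} {b : Fin n → E (d + 1)}

lemma IsLexLifting.dropLast_eq (hb : IsLexLifting a b) (i : Fin n) : dropLast d (b i) = a i := by
  obtain ⟨h, hbh, -⟩ := hb
  rw [hbh, dropLast_liftPoint]

/-- Each point of a lexicographic lifting, with label at least `d + 1`, lies on one and the same side,
indicated by the sign `s`, of all graphs spanned by earlier points. -/
lemma IsLexLifting.exists_sign (hb : IsLexLifting a b) {i : Fin n} (hi : d + 1 ≤ (i : ℕ)) :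
    ∃ s : ℝ, (s = 1 ∨ s = -1) ∧ ∀ (q : E d →ᵃ[ℝ] ℝ), ∀ T ⊆ initialPoints b i,
      affineSpan ℝ (dropLast d '' T) = ⊤ → (∀ x ∈ T, aboveGraph q x = 0) →
        0 < s * aboveGraph q (b i) := by
  obtain ⟨h, hbh, hlex⟩ := hb
  have key : ∀ (q : E d →ᵃ[ℝ] ℝ), ∀ T ⊆ initialPoints b i, affineSpan ℝ (dropLast d '' T) = ⊤ →
      (∀ x ∈ T, aboveGraph q x = 0) → ∃ (v : E (d + 1)) (t : ℝ), 0 < v (Fin.last d) ∧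
        (∀ x, aboveGraph q x = ⟪v, x⟫ - t) ∧
        ∃ S ⊆ b '' {j | j < i}, (affineSpan ℝ S : Set (E (d + 1))) = hyperplane v t := by
    intro q T hT hspan hq
    obtain ⟨v, t, hv, hvt⟩ := exists_graph_eq_hyperplane q
    refine ⟨v, t, hv, hvt, T, hT, ?_⟩
    ext x
    rw [SetLike.mem_coe, mem_affineSpan_of_graph q hq hspan, hvt, sub_eq_zero]
    rfl
  rcases hlex i hi with ⟨-, habove⟩ | ⟨-, hbelow⟩
  · refine ⟨1, Or.inl rfl, fun q T hT hspan hq => ?_⟩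
    obtain ⟨v, t, hv, hvt, hS⟩ := key q T hT hspan hq
    have := habove v t hv hS
    rw [hvt]; linarith
  · refine ⟨-1, Or.inr rfl, fun q T hT hspan hq => ?_⟩
    obtain ⟨v, t, hv, hvt, hS⟩ := key q T hT hspan hq
    have := hbelow v t hv hS
    rw [hvt]; linarith

end Lifting

/-! ### The polytope spanned by a lifting -/

section LiftedPolytope

variable {d n k : ℕ} {a : Fin n → E d} {b : Fin n → E (d + 1)} {P : Set (E d)}

/-- The fiber of the lifted polytope over a vertex of the base polytope is a single point. -/
lemma eq_of_dropLast_eq_of_mem_convexHull (ha : Function.Injective a)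
    (hab : ∀ i, dropLast d (b i) = a i) (hP : IsPolytope P) (hvert : P.extremePoints ℝ = Set.range a)
    {i : Fin n} {x : E (d + 1)} (hx : x ∈ convexHull ℝ (Set.range b)) (hxi : dropLast d x = a i) :
    x = b i := by
  have hrange : Set.range b = insert (b i) (b '' {i}ᶜ) := by
    rw [← Set.image_insert_eq, ← Set.image_univ]
    congr 1
    ext j
    simp [em]
  rcases (b '' {i}ᶜ).eq_empty_or_nonempty with hempty | hne
  · rw [hrange, hempty] at hx
    simpa using hx
  rw [hrange, convexHull_insert hne, mem_convexJoin] at hx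
  obtain ⟨_, rfl, z, hz, hxz⟩ := hx
  obtain ⟨α, β, hα, hβ, hαβ, rfl⟩ := hxz
  rcases hβ.eq_or_lt with rfl | hβ
  · simp [show α = 1 by linarith]
  exfalso
  have hzi : dropLast d z = a i := by
    rw [map_add, map_smul, map_smul, hab] at hxi
    have : β • a i = β • dropLast d z :=
      calc β • a i = a i - α • a i := by rw [show β = 1 - α by linarith, sub_smul, one_smul]
        _ = β • dropLast d z := sub_eq_iff_eq_add'.2 hxi.symm
    exact (smul_right_injective _ hβ.ne' this).symm
  have hmem : a i ∈ convexHull ℝ (a '' {i}ᶜ) := by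
    have himage : dropLast d '' (b '' {i}ᶜ) = a '' {i}ᶜ := by
      rw [Set.image_image]; exact Set.image_congr fun j _ => hab j
    rw [← himage, ← (dropLast d).image_convexHull]
    exact ⟨z, hz, hzi⟩
  have hsub : convexHull ℝ (a '' {i}ᶜ) ⊆ P := by
    rw [← hP.convexHull_extremePoints, hvert]
    exact convexHull_mono (Set.image_subset_range _ _)
  obtain ⟨j, hj, hji⟩ := extremePoints_convexHull_subset
    (inter_extremePoints_subset_extremePoints_of_subset hsub ⟨hmem, hvert ▸ Set.mem_range_self i⟩)
  exact hj (ha hji)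

lemma dropLast_mem_of_mem_convexHull (hab : ∀ i, dropLast d (b i) = a i) (hP : IsPolytope P)
    (hvert : P.extremePoints ℝ = Set.range a) {x : E (d + 1)}
    (hx : x ∈ convexHull ℝ (Set.range b)) : dropLast d x ∈ P := by
  rw [← hP.convexHull_extremePoints, hvert, ← funext hab, Set.range_comp' (dropLast d) b,
    ← (dropLast d).image_convexHull]
  exact Set.mem_image_of_mem _ hx

/-- Lifting the vertices of a polytope yields a polytope with the lifted points as vertices. -/
lemma extremePoints_convexHull_range_lift (ha : Function.Injective a)
    (hab : ∀ i, dropLast d (b i) = a i) (hP : IsPolytope P)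
    (hvert : P.extremePoints ℝ = Set.range a) :
    (convexHull ℝ (Set.range b)).extremePoints ℝ = Set.range b := by
  refine Set.Subset.antisymm extremePoints_convexHull_subset ?_
  rintro _ ⟨i, rfl⟩
  refine mem_extremePoints.2 ⟨subset_convexHull ℝ _ (Set.mem_range_self i), ?_⟩
  intro x hx y hy hxy
  have hi : a i ∈ P.extremePoints ℝ := hvert ▸ Set.mem_range_self i
  have hseg : a i ∈ openSegment ℝ (dropLast d x) (dropLast d y) := by
    obtain ⟨s, t, hs, ht, hst, h⟩ := hxy
    exact ⟨s, t, hs, ht, hst, by rw [← hab, ← h, map_add, map_smul, map_smul]⟩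
  have h := (mem_extremePoints.1 hi).2 _ (dropLast_mem_of_mem_convexHull hab hP hvert hx) _
    (dropLast_mem_of_mem_convexHull hab hP hvert hy) hseg
  exact ⟨eq_of_dropLast_eq_of_mem_convexHull ha hab hP hvert hx h.1,
    eq_of_dropLast_eq_of_mem_convexHull ha hab hP hvert hy h.2⟩

/-- Lifting the vertices of a `k`-neighborly polytope yields a `k`-neighborly polytope: supporting
hyperplanes pull back along the vertical projection. -/
lemma isNeighborlyPolytope_lift (ha : Function.Injective a)
    (hab : ∀ i, dropLast d (b i) = a i) (hP : IsNeighborlyPolytope k P)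
    (hvert : P.extremePoints ℝ = Set.range a) :
    IsNeighborlyPolytope k (convexHull ℝ (Set.range b)) := by
  classical
  have hinj : Function.Injective b := fun i j h => ha (by rw [← hab, ← hab, h])
  refine ⟨⟨Finset.univ.image b, by simp⟩, fun S hS hcard => ?_⟩
  rw [extremePoints_convexHull_range_lift ha hab hP.1 hvert] at hS
  obtain ⟨I, -, rfl⟩ := Finset.subset_set_image_iff.1 (by rwa [Set.image_univ] :
    (S : Set (E (d + 1))) ⊆ b '' Set.univ)
  rw [Finset.card_image_of_injective _ hinj] at hcard
  obtain ⟨l, hl, hl'⟩ := hP.exists_face hvert ha hcard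
  let u : E (d + 1) →ᵃ[ℝ] ℝ := l.comp (dropLast d).toAffineMap
  have hub : ∀ i, u (b i) = l (a i) := fun i => congrArg l (hab i)
  have hle : ∀ x ∈ Set.range b, u x ≤ 0 := by
    rintro _ ⟨i, rfl⟩
    rw [hub]
    by_cases hi : i ∈ I
    · exact (hl i hi).le
    · exact (hl' i hi).le
  have hle' : ∀ x ∈ convexHull ℝ (Set.range b), u x ≤ 0 := fun x hx =>
    convexHull_min (t := u ⁻¹' Set.Iic 0) hle ((convex_Iic 0).affine_preimage u) hx
  have hlin : ∀ x, u.linear x = u x - u 0 := fun x => by simpa using u.linearMap_vsub x 0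
  rintro ⟨z, hz⟩
  obtain ⟨j, hj⟩ : I.Nonempty := by
    by_contra hI
    rw [Finset.not_nonempty_iff_eq_empty] at hI
    simp [hI] at hz
  refine ⟨u.linear.toContinuousLinearMap, ?_⟩
  simp only [LinearMap.coe_toContinuousLinearMap', hlin, sub_le_sub_iff_right]
  ext x
  constructor
  · intro hx
    have hx0 : u x = 0 := convexHull_min (t := u ⁻¹' {0}) (by
      rw [Finset.coe_image]
      rintro _ ⟨i, hi, rfl⟩
      exact (hub i).trans (hl i hi)) ((convex_singleton 0).affine_preimage u) hx
    refine ⟨convexHull_mono (by simp) hx, fun y hy => ?_⟩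
    rw [hx0]
    exact hle' y hy
  · rintro ⟨hx, hmax⟩
    have hjx := hmax (b j) (subset_convexHull ℝ _ (Set.mem_range_self j))
    rw [hub, hl j hj] at hjx
    refine convexHull_mono ?_ (mem_convexHull_of_affineMap_nonneg u hle hx hjx)
    rintro _ ⟨⟨i, rfl⟩, hi⟩
    rw [Finset.coe_image]
    refine Set.mem_image_of_mem b ?_
    by_contra hiI
    rw [hub] at hi
    exact (hl' i hiI).ne hi

end LiftedPolytope

/-! ### Neighborliness of the subdivision of a lifting -/

section LiftedSubdivision

variable {d n k : ℕ} {a : Fin n → E d} {b : Fin n → E (d + 1)}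

lemma affineIndependent_image_of_dropLast {I : Finset (Fin n)} (hab : ∀ i, dropLast d (b i) = a i)
    (hI : AffineIndependent ℝ (fun i : I => a i)) :
    AffineIndependent ℝ ((↑) : ↥(b '' I) → E (d + 1)) := by
  have h : AffineIndependent ℝ (fun i : I => b i) := by
    refine AffineIndependent.of_comp (dropLast d).toAffineMap ?_
    have heq : (dropLast d).toAffineMap ∘ (fun i : I => b i) = fun i : I => a i :=
      funext fun i => hab i
    rwa [heq]
  have := h.range
  have hrange : Set.range (fun i : I => b i) = b '' I := by ext x; simp
  rwa [hrange] at this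

/-- The first `d + 2` points of a lexicographic lifting are the vertices of a simplex. -/
lemma IsLexLifting.affineIndependent_initialPoints (hb : IsLexLifting a b)
    (ha : Function.Injective a) (hgen : GeneralPosition a) (hn : d + 2 ≤ n) :
    AffineIndependent ℝ ((↑) : initialPoints b (d + 2) → E (d + 1)) := by
  have hab := hb.dropLast_eq
  let i : Fin n := ⟨d + 1, hn⟩
  let I : Finset (Fin n) := Finset.Iio i
  have hI : I.card = d + 1 := Fin.card_Iio i
  have hT : initialPoints b i = b '' I := by
    simp only [initialPoints, I, Finset.coe_Iio]; rfl
  have hIa := hgen.affineIndependent (by omega) hI.le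
  have hind : AffineIndependent ℝ ((↑) : initialPoints b i → E (d + 1)) := by
    rw [hT]; exact affineIndependent_image_of_dropLast hab hIa
  have hrange : Set.range (fun i : I => a i) = a '' I := by ext x; simp
  obtain ⟨q, hq⟩ := exists_affineMap_eqOn (I.finite_toSet.image a) (hrange ▸ hIa.range)
    (Function.extend a (fun j => height d (b j)) 0)
  have hqI : ∀ x ∈ initialPoints b i, aboveGraph q x = 0 := by
    rw [hT]
    rintro _ ⟨j, hj, rfl⟩
    rw [aboveGraph_apply, hab, hq _ (Set.mem_image_of_mem a hj), ha.extend_apply, sub_self]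
  have hspan : affineSpan ℝ (dropLast d '' initialPoints b i) = ⊤ := by
    rw [hT, Set.image_image]
    simp only [hab]
    exact hgen.affineSpan_image_eq_top hI.ge
  obtain ⟨s, -, hs⟩ := hb.exists_sign (i := i) le_rfl
  have hpos := hs q _ subset_rfl hspan hqI
  have hnot : b i ∉ affineSpan ℝ (initialPoints b i) := by
    rw [mem_affineSpan_of_graph q hqI hspan]
    intro h
    rw [h, mul_zero] at hpos
    exact lt_irrefl _ hpos
  have := affineIndependent_insert hnot hind
  rwa [← initialPoints_succ] at this

lemma IsLexLifting.affineSpan_initialPoints (hb : IsLexLifting a b)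
    (ha : Function.Injective a) (hgen : GeneralPosition a) (hn : d + 2 ≤ n) :
    affineSpan ℝ (initialPoints b (d + 2)) = ⊤ := by
  have hinj : Function.Injective b := fun i j h => ha (by rw [← hb.dropLast_eq, ← hb.dropLast_eq, h])
  rw [affineSpan_eq_top_iff_ncard_eq (initialPoints_finite b _)
    (hb.affineIndependent_initialPoints ha hgen hn), initialPoints, Set.ncard_image_of_injective _ hinj]
  have : {j : Fin n | (j : ℕ) < d + 2} = (Finset.univ.filter fun j : Fin n => (j : ℕ) < d + 2) := by
    ext; simp
  rw [this, Set.ncard_coe_finset, Fin.card_filter_val_lt]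
  omega

/-- A face of the base polytope spanned by earlier points lifts to a face of the lifted polytope of
earlier points that is visible from the new point: the vertical supporting hyperplane over the face
can be tilted until it is the graph of an affine function spanned by lifted points, and the new point
lies beyond this graph. -/
lemma IsLexLifting.exists_visible_face (hb : IsLexLifting a b) (ha : Function.Injective a)
    (hgen : GeneralPosition a) {i : Fin n} (hi : d + 1 ≤ (i : ℕ)) {I : Finset (Fin n)}
    (hIi : ∀ j ∈ I, j < i) (hIind : AffineIndependent ℝ (fun j : I => a j)) (l : E d →ᵃ[ℝ] ℝ)
    (hl : ∀ j ∈ I, l (a j) = 0) (hl' : ∀ j ∉ I, l (a j) < 0) :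
    ∃ u : E (d + 1) →ᵃ[ℝ] ℝ, (∀ x ∈ b '' I, u x = 0) ∧
      (∀ x ∈ initialPoints b i, x ∉ b '' I → u x < 0) ∧ 0 < u (b i) := by
  have hab := hb.dropLast_eq
  obtain ⟨s, hs1, hs⟩ := hb.exists_sign hi
  have hss : s * s = 1 := by rcases hs1 with rfl | rfl <;> norm_num
  -- The heights, taken with the sign `s`, as a function on the base points.
  let F : E d → ℝ := Function.extend a (fun j => s * height d (b j)) 0
  have hF : ∀ j, F (a j) = s * height d (b j) := fun j => ha.extend_apply _ _ j
  have hrange : Set.range (fun i : I => a i) = a '' I := by ext x; simp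
  have hsub : a '' I ⊆ initialPoints a i := Set.image_mono hIi
  have hcell : IsLowerCell (fun y => -F y) (initialPoints a i) (a '' I) := by
    refine isLowerCell_of_face (initialPoints_finite a i) hsub (hrange ▸ hIind.range) l ?_ ?_
    · rintro _ ⟨j, hj, rfl⟩
      exact hl j hj
    · rintro _ ⟨j, -, rfl⟩ hjI
      exact hl' j fun h => hjI (Set.mem_image_of_mem a h)
  have hspan : affineSpan ℝ (initialPoints a i) = ⊤ := by
    have h := hgen.affineSpan_image_eq_top (I := Finset.Iio i) (by rw [Fin.card_Iio]; exact hi)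
    rw [← h, initialPoints, Finset.coe_Iio]; rfl
  obtain ⟨g₀, hg₀, hg₀le, -⟩ := hcell.exists_le
  obtain ⟨g, hgle, hcont, htop⟩ := exists_le_affineSpan_eq_top (initialPoints_finite a i) hspan g₀ hg₀le
  let q : E d →ᵃ[ℝ] ℝ := (-s) • g
  have hq : ∀ j, s * aboveGraph q (b j) = F (a j) + g (a j) := by
    intro j
    rw [aboveGraph_apply, hab, hF]
    simp only [q, AffineMap.coe_smul, Pi.smul_apply, smul_eq_mul]
    linear_combination (g (a j)) * hss
  have hpos : 0 < s * aboveGraph q (b i) := by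
    refine hs q {x ∈ initialPoints b i | aboveGraph q x = 0} (Set.sep_subset _ _) ?_ fun x hx => hx.2
    refine top_le_iff.1 (htop ▸ affineSpan_mono ℝ ?_)
    rintro _ ⟨⟨j, hj, rfl⟩, hgj⟩
    refine ⟨b j, ⟨⟨j, hj, rfl⟩, ?_⟩, hab j⟩
    have hs0 : s ≠ 0 := by rintro rfl; simp at hss
    have := hq j
    rw [hgj, add_neg_cancel] at this
    exact (mul_eq_zero.1 this).resolve_left hs0
  obtain ⟨ε, hε, hεlt⟩ := exists_pos_forall_mul_lt (Set.finite_singleton (b i))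
    (fun x => s * aboveGraph q x) (fun x => -l (dropLast d x)) (by rintro _ rfl; exact hpos)
  refine ⟨s • aboveGraph q + ε • l.comp (dropLast d).toAffineMap, ?_, ?_, ?_⟩
  · rintro _ ⟨j, hj, rfl⟩
    have hmem := Set.mem_image_of_mem a (Finset.mem_coe.2 hj)
    have h1 := hcont _ (hsub hmem) (hg₀ _ hmem)
    have h2 := hq j
    simp only [AffineMap.coe_add, AffineMap.coe_smul, Pi.add_apply, Pi.smul_apply, smul_eq_mul,
      AffineMap.comp_apply, LinearMap.coe_toAffineMap, hab, hl j hj]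
    linarith
  · rintro _ ⟨j, hj, rfl⟩ hjI
    have h1 := hgle (a j) (Set.mem_image_of_mem a hj)
    have h2 := hq j
    have h3 := hl' j fun h => hjI (Set.mem_image_of_mem b h)
    simp only [AffineMap.coe_add, AffineMap.coe_smul, Pi.add_apply, Pi.smul_apply, smul_eq_mul,
      AffineMap.comp_apply, LinearMap.coe_toAffineMap, hab]
    nlinarith
  · have := hεlt (b i) rfl
    simp only [AffineMap.coe_add, AffineMap.coe_smul, Pi.add_apply, Pi.smul_apply, smul_eq_mul,
      AffineMap.comp_apply, LinearMap.coe_toAffineMap]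
    linarith

/-- The placing subdivision of a lexicographic lifting of a `k`-neighborly point configuration is
`(k + 1)`-neighborly: a cell is created when its last point is placed. -/
lemma IsLexLifting.isLowerCell_image (hb : IsLexLifting a b) (ha : Function.Injective a)
    (hgen : GeneralPosition a) (hn : d + 2 ≤ n) {G : E (d + 1) → ℝ} (hpl : IsPlacing G b (d + 2))
    (hface : ∀ I : Finset (Fin n), I.card = k →
      ∃ l : E d →ᵃ[ℝ] ℝ, (∀ i ∈ I, l (a i) = 0) ∧ ∀ i ∉ I, l (a i) < 0)
    {I : Finset (Fin n)} (hI : I.card = k + 1) : IsLowerCell G (Set.range b) (b '' I) := by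
  classical
  have hab := hb.dropLast_eq
  have hinj : Function.Injective b := fun i j h => ha (by rw [← hab, ← hab, h])
  have hind := hb.affineIndependent_initialPoints ha hgen hn
  have hspan := hb.affineSpan_initialPoints ha hgen hn
  have hne : I.Nonempty := Finset.card_pos.1 (by omega)
  set i := I.max' hne with hidef
  have hiI : i ∈ I := I.max'_mem hne
  rw [← initialPoints_eq_range]
  rcases lt_or_ge (i : ℕ) (d + 2) with hi | hi
  · have hwhole : IsLowerCell G (initialPoints b (d + 2)) (initialPoints b (d + 2)) :=
      isLowerCell_of_face (initialPoints_finite b _) subset_rfl hind 0 (by simp)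
        fun x hx hx' => absurd hx hx'
    refine (hwhole.of_subset (initialPoints_finite b _) hind ?_).persist hinj hind hspan hpl le_rfl hn
      le_rfl
    exact Set.image_mono fun j hj => lt_of_le_of_lt (Fin.le_def.1 (I.le_max' j hj)) hi
  · obtain ⟨l, hl, hl'⟩ := hface (I.erase i) (by rw [Finset.card_erase_of_mem hiI, hI]; rfl)
    have hcard := hgen.card_le l hl (x := a i) (hl' i (Finset.notMem_erase i I)).ne
    have hIind := hgen.affineIndependent (by omega) (hcard.trans d.le_succ)
    have hlt : ∀ j ∈ I.erase i, j < i := fun j hj =>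
      lt_of_le_of_ne (I.le_max' j (Finset.mem_of_mem_erase hj)) (Finset.ne_of_mem_erase hj)
    obtain ⟨u, hu, hu', hui⟩ := hb.exists_visible_face ha hgen (by omega) hlt hIind l hl hl'
    have := (isLowerCell_insert hinj hind hspan hpl hi (Set.image_mono hlt)
      (affineIndependent_image_of_dropLast hab hIind) u hu hu' hui).persist hinj hind hspan hpl
      (hi.trans i.val.le_succ) i.2 le_rfl
    rwa [← Set.image_insert_eq, ← Finset.coe_insert, Finset.insert_erase hiI] at this

end LiftedSubdivision

/-! ### Delaunay subdivisions -/

section Delaunay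

variable {m : ℕ} {K : Set (E (m + 1))} {σ : StereographicProjection K} {G : E m → ℝ}

/-- The Delaunay subdivision is the regular subdivision with heights `G`. -/
lemma mem_delaunay_iff (hG0 : ∀ p, 0 < G p)
    (hG : ∀ g : E m →ᵃ[ℝ] ℝ, g ≠ 0 → ∃ H, IsHyperplane H ∧ σ.center ∉ H ∧
      σ.sphere H = {p | G p = g p} ∧ σ.ball H = {p | G p ≤ g p})
    (hG' : ∀ H, IsHyperplane H → σ.center ∉ H → ∃ g : E m →ᵃ[ℝ] ℝ,
      σ.sphere H = {p | G p = g p} ∧ σ.ball H = {p | G p ≤ g p})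
    {A : Set (E m)} {S : Finset (E m)} : S ∈ σ.delaunay A ↔ IsLowerCell G A S := by
  constructor
  · rintro ⟨hSA, H, hH, hcH, hS, hA⟩
    obtain ⟨g, hsphere, hball⟩ := hG' H hH hcH
    refine ⟨hSA, g, fun x hx => ?_, fun x hx hxS => ?_⟩
    · have := hS hx
      rw [hsphere] at this
      exact Eq.symm this
    · have := hA x hx hxS
      rw [hball] at this
      exact not_le.1 this
  · rintro ⟨hSA, g, hg, hlt⟩
    -- If `g` is zero, then `S` is empty and any negative constant serves as well.
    obtain ⟨g', hg'0, hg', hlt'⟩ : ∃ g' : E m →ᵃ[ℝ] ℝ, g' ≠ 0 ∧ (∀ x ∈ S, g' x = G x) ∧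
        ∀ x ∈ A, x ∉ S → g' x < G x := by
      by_cases h0 : g = 0
      · refine ⟨AffineMap.const ℝ _ (-1), fun h => ?_, fun x hx => ?_, fun x _ _ => ?_⟩
        · have := congrArg (fun f : E m →ᵃ[ℝ] ℝ => f 0) h
          norm_num at this
        · have := hg x hx
          rw [h0] at this
          exact absurd this (hG0 x).ne
        · have := hG0 x
          simp
          linarith
      · exact ⟨g, h0, hg, hlt⟩
    obtain ⟨H, hH, hcH, hsphere, hball⟩ := hG g' hg'0
    refine ⟨hSA, H, hH, hcH, fun x hx => ?_, fun x hx hxS => ?_⟩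
    · rw [hsphere]; exact (hg' x hx).symm
    · rw [hball]; exact not_le.2 (hlt' x hx hxS)

/-- The circumball condition on a `K`-lifting is the placing condition for the heights `G`. -/
lemma IsKLifting.isPlacing {d n : ℕ} {K : Set (E (d + 1 + 1))} {σ : StereographicProjection K}
    {a : Fin n → E d} {b : Fin n → E (d + 1)} (hb : IsKLifting σ a b) {G : E (d + 1) → ℝ}
    (hG0 : ∀ p, 0 < G p)
    (hG : ∀ g : E (d + 1) →ᵃ[ℝ] ℝ, g ≠ 0 → ∃ H, IsHyperplane H ∧ σ.center ∉ H ∧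
      σ.sphere H = {p | G p = g p} ∧ σ.ball H = {p | G p ≤ g p}) : IsPlacing G b (d + 2) := by
  intro i hi S hS hind hspan g hg
  have hfin : S.Finite := (initialPoints_finite b i).subset hS
  have hcard := (affineSpan_eq_top_iff_ncard_eq hfin hind).1 hspan
  lift S to Finset (E (d + 1)) using hfin
  rw [Set.ncard_coe_finset] at hcard
  have hg0 : g ≠ 0 := by
    rintro rfl
    obtain ⟨x, hx⟩ := Finset.card_pos.1 (by omega : 0 < S.card)
    exact (hG0 x).ne (hg x hx)
  obtain ⟨H, hH, hcH, hsphere, hball⟩ := hG g hg0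
  have := hb.2 i hi S (σ.ball H) hS ⟨hcard, hind, H, hH, hcH, fun x hx => by
    rw [hsphere]; exact (hg x hx).symm, rfl⟩
  rw [hball] at this
  exact not_le.1 this

end Delaunay

end Neighborly

end

open Neighborly in
theorem theorem5p3 {d n k : ℕ} (hn : d + 2 ≤ n)
    (K : Set (Neighborly.E (d + 2))) (hK : Neighborly.IsSmoothStrictlyConvexBody K)
    (σ : Neighborly.StereographicProjection (m := d + 1) K)
    (a : Fin n → Neighborly.E d) (ha : Function.Injective a)
    (hgen : Neighborly.GeneralPosition a)
    (P : Set (Neighborly.E d)) (hP : Neighborly.IsNeighborlyPolytope k P)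
    (hdim : affineSpan ℝ P = ⊤) (hvert : P.extremePoints ℝ = Set.range a)
    (b : Fin n → Neighborly.E (d + 1)) (hb : Neighborly.IsKLifting σ a b) :
    (Neighborly.IsNeighborlyPolytope k (convexHull ℝ (Set.range b)) ∧
      (convexHull ℝ (Set.range b)).extremePoints ℝ = Set.range b) ∧
    Neighborly.IsNeighborlyTriangulation (k + 1) (Set.range b) (σ.delaunay (Set.range b)) := by
  classical
  have hab := hb.1.dropLast_eq
  have hinj : Function.Injective b := fun i j h => ha (by rw [← hab, ← hab, h])
  refine ⟨⟨isNeighborlyPolytope_lift ha hab hP hvert,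
    extremePoints_convexHull_range_lift ha hab hP.1 hvert⟩, ?_⟩
  obtain ⟨G, hG0, hG, hG'⟩ := σ.exists_height hK
  have hdel : ∀ {S : Finset (Neighborly.E (d + 1))},
      S ∈ σ.delaunay (Set.range b) ↔ IsLowerCell G (Set.range b) S := mem_delaunay_iff hG0 hG hG'
  have hpl := hb.isPlacing hG0 hG
  have hind := hb.1.affineIndependent_initialPoints ha hgen hn
  have hspan := hb.1.affineSpan_initialPoints ha hgen hn
  have hfin : (Set.range b).Finite := Set.finite_range b
  have hcellind : ∀ {S : Set (Neighborly.E (d + 1))}, IsLowerCell G (Set.range b) S →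
      AffineIndependent ℝ ((↑) : S → Neighborly.E (d + 1)) := fun hS =>
    IsLowerCell.affineIndependent hinj hind hspan hpl hn le_rfl (by rwa [initialPoints_eq_range])
  refine ⟨⟨fun S hS => hS.1, fun S hS => hcellind (hdel.1 hS), fun S hS S' hS' => ?_, ?_,
    fun S hS S' hS' => (hdel.1 hS).convexHull_inter (hdel.1 hS')⟩, fun S hS hcard => ?_⟩
  · exact hdel.2 ((hdel.1 hS).of_subset hfin (hcellind (hdel.1 hS)) (Finset.coe_subset.2 hS'))
  · refine Set.Subset.antisymm (Set.iUnion₂_subset fun S hS => convexHull_mono hS.1) ?_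
    refine (convexHull_subset_iUnion_isLowerCell (G := G) hfin ?_).trans ?_
    · rw [← initialPoints_eq_range]
      exact affineSpan_initialPoints_eq_top hspan hn
    · refine Set.iUnion₂_subset fun S hS => ?_
      lift S to Finset (Neighborly.E (d + 1)) using hfin.subset hS.1
      exact Set.subset_biUnion_of_mem (u := fun S : Finset (Neighborly.E (d + 1)) =>
        convexHull ℝ (S : Set (Neighborly.E (d + 1)))) (hdel.2 hS)
  · obtain ⟨I, -, rfl⟩ := Finset.subset_set_image_iff.1 (by rwa [Set.image_univ] :
      (S : Set (Neighborly.E (d + 1))) ⊆ b '' Set.univ)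
    rw [Finset.card_image_of_injective _ hinj] at hcard
    rw [hdel, Finset.coe_image]
    exact hb.1.isLowerCell_image ha hgen hn hpl (fun I hI => hP.exists_face hvert ha hI) hcard
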